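/- **Setting.** Let $G=SL(3,\mathbb C)$, let $U=\mathbb C^3$ be its standard representation with standard basis $e_1,e_2,e_3$, and let $e_1^*,e_2^*,e_3^*$ be the dual basis of $U^*$. For $a,b\ge 0$ let $\Gamma_{a,b}$ be the kernel of the contraction $\operatorname{Sym}^aU\otimes\operatorname{Sym}^bU^*\to\operatorname{Sym}^{a-1}U\otimes\operatorname{Sym}^{b-1}U^*$ (the whole space if $a=0$ or $b=0$). For a maximal torus $T\subset G$ and a vector $x$ of a rational representation, the weight polytope $\mathcal N_T(x)\subset \operatorname{Lie}(T)^*$ is the convex hull of the weights $\sigma$ of $T$ for which the $\sigma$-component of $x$ is nonzero. Let $T_0$ be the diagonal torus and $L_i$ the weight of $e_i$, so $L_1+L_2+L_3=0$. For a representation $V$ let $\mathcal N(V)$ be the convex hull of all its $T_0$-weights. For rational representations $V,W$ of $G$ and nonzero vectors $v\in V$, $w\in W$: * $(v,w)$ is *semistable* if in $\mathbb P(V\oplus W)$ the closures of the orbits $G\cdot[(v,w)]$ and $G\cdot[(v,0)]$ are disjoint. * $(v,w)$ is *numerically semistable* if $\mathcal N_T(v)\subset\mathcal N_T(w)$ for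 all maximal tori $T$ of $G$. * $(v,w)$ is *numerically stable* if there is an integer $m\ge 1$ such that $(I^{\otimes\deg V}\otimes v^{\otimes m},\,w^{\otimes(m+1)})$ is numerically semistable. Here $I=e_1\oplus e_2\oplus e_3\in M_3=U\oplus U\oplus U$ and $\deg V=\min\{d\in\mathbb Z_{>0}:\mathcal N(V)\subset d\,\mathcal N(M_3)\}$. **Proposition 3.1.** Let $k\ge 12$, $V=\Gamma_{0,k+1}$, $W=\Gamma_{2k,1}$, $v=(e_2^*)^2(e_3^*)^{k-1}\in V$ and $$w_0=e_2^{2k-1}\bigl(e_2\otimes e_2^*-(2k+1)\,e_1\otimes e_1^*+e_3\otimes e_3^*\bigr)+e_1^{2k-1}\bigl(-\tfrac1k\,e_1\otimes e_1^*+e_2\otimes e_2^*+e_3\otimes e_3^*\bigr)\in W.$$ Let $W=\bigoplus_\sigma W_\sigma$ be the weight decomposition under $T_0$, let $l_3(a_1L_1+a_2L_2+a_3L_3)=a_1+a_2-2a_3$, and let $W'=\bigoplus_{l_3(\sigma)\le 2k-7}W_\sigma$. Then for generic $w'\in W'$ (that is, for all $w'$ in some nonempty Zariski open subset of $W'$),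 with $w=w_0+w'$, the pair $(v,w)$ is numerically semistable, and in fact numerically stable, but it is not semistable. -/

import Mathlib

open MvPolynomial
open scoped TensorProduct Pointwise LinearAlgebra.Projectivization

noncomputable section

namespace PairStability

/-- The group `SL(3, ℂ)`. -/
abbrev SL3 : Type := Matrix.SpecialLinearGroup (Fin 3) ℂ

/-! ### Semistable pairs -/

section Semistable

variable {V W : Type} [AddCommGroup V] [Module ℂ V] [AddCommGroup W] [Module ℂ W]

/-- The topology of the projective space `ℙ(E)` of a complex vector space `E`: the quotient of the
canonical vector space topology on `E \ {0}` (for finite-dimensional `E`, the module topology is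
the usual topology). -/
abbrev projTopology (E : Type) [AddCommGroup E] [Module ℂ E] : TopologicalSpace (ℙ ℂ E) :=
  TopologicalSpace.coinduced (fun x : {x : E // x ≠ 0} => Projectivization.mk ℂ x.1 x.2)
    (TopologicalSpace.induced Subtype.val (moduleTopology ℂ E))

/-- The orbit `SL(3, ℂ) · [(v, w)]` in `ℙ(V ⊕ W)`. -/
def orbit (ρ : Representation ℂ SL3 V) (τ : Representation ℂ SL3 W) (v : V) (w : W) :
    Set (ℙ ℂ (V × W)) :=
  {p | ∃ (A : SL3) (h : (ρ A v, τ A w) ≠ 0), p = Projectivization.mk ℂ (ρ A v, τ A w) h}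

/-- The pair `(v, w)` is semistable: the closures in `ℙ(V ⊕ W)` of the orbits of `[(v, w)]` and of
`[(v, 0)]` do not meet. -/
def IsSemistable (ρ : Representation ℂ SL3 V) (τ : Representation ℂ SL3 W) (v : V) (w : W) :
    Prop :=
  @closure _ (projTopology (V × W)) (orbit ρ τ v w) ∩
    @closure _ (projTopology (V × W)) (orbit ρ τ v 0) = ∅

end Semistable

/-! ### Maximal tori and weight polytopes -/

/-- `χ` is an isomorphism of `(ℂˣ)ʳ` onto an algebraic torus of `SL(3, ℂ)`: an injective group
homomorphism whose matrix entries are Laurent polynomials. -/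
def IsTorusParam {r : ℕ} (χ : (Fin r → ℂˣ) →* SL3) : Prop :=
  Function.Injective χ ∧
    ∀ i j : Fin 3, ∃ c : (Fin r → ℤ) →₀ ℂ, ∀ t : Fin r → ℂˣ,
      (χ t).1 i j = c.sum fun a z => z * ((∏ l, t l ^ a l : ℂˣ) : ℂ)

/-- A subgroup of `SL(3, ℂ)` is an algebraic torus. -/
def IsTorus (T : Subgroup SL3) : Prop :=
  ∃ (r : ℕ) (χ : (Fin r → ℂˣ) →* SL3), IsTorusParam χ ∧ χ.range = T

section Weights

variable {V W : Type} [AddCommGroup V] [Module ℂ V] [AddCommGroup W] [Module ℂ W] {r : ℕ}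

/-- The weight space of the character `t ↦ t₁^{a₁} ⋯ t_r^{a_r}` of a parametrized torus. -/
def weightSpace (ρ : Representation ℂ SL3 V) (χ : (Fin r → ℂˣ) →* SL3) (a : Fin r → ℤ) :
    Submodule ℂ V where
  carrier := {x | ∀ t : Fin r → ℂˣ, ρ (χ t) x = ((∏ l, t l ^ a l : ℂˣ) : ℂ) • x}
  add_mem' := by
    intro x y hx hy t
    rw [map_add, hx t, hy t, smul_add]
  zero_mem' := by
    intro t
    rw [map_zero, smul_zero]
  smul_mem' := by
    intro c x hx t
    rw [map_smul, hx t, smul_comm]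

/-- The weights `a` such that the component `f a` of `x` in the weight space of `a` is nonzero,
where `x = ∑ b, f b` is the decomposition of `x` into weight vectors. -/
def weights (ρ : Representation ℂ SL3 V) (χ : (Fin r → ℂˣ) →* SL3) (x : V) : Set (Fin r → ℤ) :=
  {a | ∃ f : (Fin r → ℤ) →₀ V,
    (∀ b, f b ∈ weightSpace ρ χ b) ∧ (f.sum fun _ y => y) = x ∧ f a ≠ 0}

/-- The inclusion of the character lattice `ℤʳ` of the torus into `Lie(T)^* = ℝʳ`. -/
def toReal (a : Fin r → ℤ) : Fin r → ℝ := fun l => (a l : ℝ)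

/-- The weight polytope `𝒩_T(x)` of a vector `x`, for the torus `T` parametrized by `χ`, which
identifies the space `Lie(T)^*` with `ℝʳ`. -/
def weightPolytope (ρ : Representation ℂ SL3 V) (χ : (Fin r → ℂˣ) →* SL3) (x : V) :
    Set (Fin r → ℝ) :=
  convexHull ℝ (toReal '' weights ρ χ x)

/-- The weight polytope of a representation, that is, of a generic vector of it: the convex hull
of all its weights. -/
def repPolytope (ρ : Representation ℂ SL3 V) (χ : (Fin r → ℂˣ) →* SL3) : Set (Fin r → ℝ) :=
  convexHull ℝ (toReal '' {a | weightSpace ρ χ a ≠ ⊥})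

/-- The pair `(v, w)` is numerically semistable: `𝒩_T(v) ⊆ 𝒩_T(w)` for all maximal tori `T`. -/
def IsNumSemistable (ρ : Representation ℂ SL3 V) (τ : Representation ℂ SL3 W) (v : V) (w : W) :
    Prop :=
  ∀ (r : ℕ) (χ : (Fin r → ℂˣ) →* SL3), IsTorusParam χ → Maximal IsTorus χ.range →
    weightPolytope ρ χ v ⊆ weightPolytope τ χ w

end Weights

/-- The standard maximal torus `T₀` of diagonal matrices, `(t₁, t₂) ↦ diag(t₁, t₂, (t₁ t₂)⁻¹)`.
The weight `(a₁, a₂)` is the weight `a₁ L₁ + a₂ L₂`, and `L₃ = -L₁ - L₂`. -/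
def stdTorus : (Fin 2 → ℂˣ) →* SL3 where
  toFun t := ⟨Matrix.diagonal ![(t 0 : ℂ), (t 1 : ℂ), ((t 0)⁻¹ * (t 1)⁻¹ : ℂˣ)], by
    rw [Matrix.det_diagonal, Fin.prod_univ_three]
    have h0 := (t 0).ne_zero
    have h1 := (t 1).ne_zero
    simp
    field_simp⟩
  map_one' := by
    ext i j
    fin_cases i <;> fin_cases j <;> simp
  map_mul' s t := by
    apply Subtype.ext
    refine Eq.trans ?_ (Matrix.diagonal_mul_diagonal _ _).symm
    refine congrArg Matrix.diagonal (funext fun i => ?_)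
    fin_cases i <;> simp
    ring

/-! ### Numerically stable pairs -/

section Stable

variable {V W : Type} [AddCommGroup V] [Module ℂ V] [AddCommGroup W] [Module ℂ W]

/-- The standard representation of `SL(3, ℂ)` on `U = ℂ³`. -/
def stdRep : Representation ℂ SL3 (Fin 3 → ℂ) where
  toFun A := A.1.mulVecLin
  map_one' := by
    simp [Module.End.one_eq_id]
  map_mul' A B := by
    simp [Matrix.mulVecLin_mul, Module.End.mul_eq_comp]

/-- The representation `M₃ = U ⊕ U ⊕ U`. -/
def repM3 : Representation ℂ SL3 (Fin 3 → Fin 3 → ℂ) where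
  toFun A := LinearMap.pi fun i => stdRep A ∘ₗ LinearMap.proj i
  map_one' := by
    ext
    simp
  map_mul' A B := by
    ext
    simp

/-- The vector `I = e₁ ⊕ e₂ ⊕ e₃` of `M₃`. -/
def vecI : Fin 3 → Fin 3 → ℂ := fun i => Pi.single i 1

/-- The degree of a representation: the least positive integer `d` with `𝒩(V) ⊆ d 𝒩(M₃)`, for
the weight polytopes with respect to the standard torus. -/
def repDegree (ρ : Representation ℂ SL3 V) : ℕ :=
  sInf {d : ℕ | 0 < d ∧ repPolytope ρ stdTorus ⊆ (d : ℝ) • repPolytope repM3 stdTorus}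

/-- The tensor power of a representation. -/
def tensorPow (ρ : Representation ℂ SL3 V) (m : ℕ) :
    Representation ℂ SL3 (⨂[ℂ] (_ : Fin m), V) where
  toFun A := PiTensorProduct.map fun _ => ρ A
  map_one' := by
    simp [Module.End.one_eq_id, PiTensorProduct.map_id]
  map_mul' A B := by
    simp only [map_mul]
    exact PiTensorProduct.map_mul _ _

/-- The vector `x^{⊗ m}`. -/
def vecPow (x : V) (m : ℕ) : ⨂[ℂ] (_ : Fin m), V :=
  PiTensorProduct.tprod ℂ fun _ => x

/-- The pair `(v, w)` is numerically stable: for some positive integer `m` the pair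
`(I^{⊗ deg V} ⊗ v^{⊗ m}, w^{⊗ (m + 1)})` is numerically semistable. -/
def IsNumStable (ρ : Representation ℂ SL3 V) (τ : Representation ℂ SL3 W) (v : V) (w : W) :
    Prop :=
  ∃ m : ℕ, 0 < m ∧
    IsNumSemistable ((tensorPow repM3 (repDegree ρ)).tprod (tensorPow ρ m)) (tensorPow τ (m + 1))
      (vecPow vecI (repDegree ρ) ⊗ₜ[ℂ] vecPow v m) (vecPow w (m + 1))

end Stable

/-! ### The representations `Γ_{a,b}` -/

/-- The symmetric algebra of `U ⊕ U^*`: polynomials in the basis vectors `e₁, e₂, e₃` of `U` and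
`e₁^*, e₂^*, e₃^*` of `U^*`. Its part of bidegree `(a, b)` is `Sym^a U ⊗ Sym^b U^*`. -/
abbrev Poly : Type := MvPolynomial (Fin 3 ⊕ Fin 3) ℂ

/-- The basis vector `e_i` (with indices `0, 1, 2` for `1, 2, 3`). -/
def eVec (i : Fin 3) : Poly := X (Sum.inl i)

/-- The dual basis vector `e_i^*`. -/
def eDual (i : Fin 3) : Poly := X (Sum.inr i)

/-- The action of `A = (a_{ij})` on polynomials, by `A e_j = ∑ a_{ij} e_i` and
`A e_j^* = ∑ b_{ij} e_i^*`, with `(b_{ij})` the transpose of the inverse of `A`. -/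
def act (A : SL3) : Poly →ₐ[ℂ] Poly :=
  aeval (Sum.elim (fun j => ∑ i, C (A.1 i j) * eVec i) (fun j => ∑ i, C ((A⁻¹).1 j i) * eDual i))

lemma act_eVec (A : SL3) (j : Fin 3) : act A (eVec j) = ∑ i, C (A.1 i j) * eVec i := by
  simp [act, eVec]

lemma act_eDual (A : SL3) (j : Fin 3) : act A (eDual j) = ∑ i, C ((A⁻¹).1 j i) * eDual i := by
  simp [act, eDual]

lemma act_one : act 1 = AlgHom.id ℂ Poly := by
  apply MvPolynomial.algHom_ext
  rintro (j | j)
  · change act 1 (eVec j) = eVec j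
    simp [act_eVec, Matrix.one_apply]
  · change act 1 (eDual j) = eDual j
    simp [act_eDual, Matrix.one_apply]

lemma act_C (A : SL3) (c : ℂ) : act A (C c) = C c := by
  simp [act]

lemma act_mul (A B : SL3) : act (A * B) = (act A).comp (act B) := by
  apply MvPolynomial.algHom_ext
  rintro (j | j)
  · change act (A * B) (eVec j) = act A (act B (eVec j))
    simp only [act_eVec, map_sum, map_mul, act_C, Matrix.SpecialLinearGroup.coe_mul,
      Matrix.mul_apply, Finset.sum_mul, Finset.mul_sum]
    rw [Finset.sum_comm]
    refine Finset.sum_congr rfl fun i _ => Finset.sum_congr rfl fun l _ => by ring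
  · change act (A * B) (eDual j) = act A (act B (eDual j))
    simp only [act_eDual, map_sum, map_mul, act_C, mul_inv_rev, Matrix.SpecialLinearGroup.coe_mul,
      Matrix.mul_apply, Finset.sum_mul, Finset.mul_sum]
    rw [Finset.sum_comm]
    refine Finset.sum_congr rfl fun i _ => Finset.sum_congr rfl fun l _ => by ring

/-- The bidegree: `e_i` has bidegree `(1, 0)` and `e_i^*` has bidegree `(0, 1)`. -/
def bideg : Fin 3 ⊕ Fin 3 → ℕ × ℕ := Sum.elim (fun _ => (1, 0)) (fun _ => (0, 1))

/-- The contraction `∑ ∂/∂e_i ∂/∂e_i^*`. On the part of bidegree `(a, b)` with `a, b ≥ 1` it is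
`a b` times the map `∏ x_p ⊗ ∏ φ_q ↦ (a b)⁻¹ ∑_{p,q} φ_q(x_p) ∏_{p' ≠ p} x_{p'} ⊗ ∏_{q' ≠ q} φ_{q'}`
to bidegree `(a - 1, b - 1)`, and it vanishes if `a = 0` or `b = 0`. -/
def contraction : Poly →ₗ[ℂ] Poly :=
  ∑ i : Fin 3, (pderiv (Sum.inl i)).toLinearMap ∘ₗ (pderiv (Sum.inr i)).toLinearMap

lemma contraction_apply (p : Poly) :
    contraction p = ∑ i : Fin 3, pderiv (Sum.inl i) (pderiv (Sum.inr i) p) := by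
  simp [contraction]

/-- The space `Γ_{a,b}`: the kernel of the contraction on `Sym^a U ⊗ Sym^b U^*`. -/
def Gam (a b : ℕ) : Submodule ℂ Poly :=
  weightedHomogeneousSubmodule ℂ bideg (a, b) ⊓ LinearMap.ker contraction

lemma pderiv_inl_act (A : SL3) (i : Fin 3) (p : Poly) :
    pderiv (Sum.inl i) (act A p) = ∑ j, C (A.1 i j) * act A (pderiv (Sum.inl j) p) := by
  induction p using MvPolynomial.induction_on with
  | C c => simp
  | add p q hp hq => simp only [map_add, hp, hq, mul_add, Finset.sum_add_distrib]
  | mul_X p n hp =>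
    have hX : pderiv (Sum.inl i) (act A (X n)) =
        ∑ j, C (A.1 i j) * act A (pderiv (Sum.inl j) (X n)) := by
      rcases n with n | n
      · change pderiv (Sum.inl i) (act A (eVec n)) = _
        rw [act_eVec]
        simp [eVec, pderiv_X, Pi.single_apply, Finset.sum_ite_eq]
      · change pderiv (Sum.inl i) (act A (eDual n)) = _
        rw [act_eDual]
        simp [eDual, pderiv_X]
    rw [map_mul, pderiv_mul, hp, hX, Finset.sum_mul, Finset.mul_sum, ← Finset.sum_add_distrib]
    refine Finset.sum_congr rfl fun j _ => ?_
    rw [pderiv_mul, map_add, map_mul, map_mul]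
    ring

lemma pderiv_inr_act (A : SL3) (i : Fin 3) (p : Poly) :
    pderiv (Sum.inr i) (act A p) = ∑ j, C ((A⁻¹).1 j i) * act A (pderiv (Sum.inr j) p) := by
  induction p using MvPolynomial.induction_on with
  | C c => simp
  | add p q hp hq => simp only [map_add, hp, hq, mul_add, Finset.sum_add_distrib]
  | mul_X p n hp =>
    have hX : pderiv (Sum.inr i) (act A (X n)) =
        ∑ j, C ((A⁻¹).1 j i) * act A (pderiv (Sum.inr j) (X n)) := by
      rcases n with n | n
      · change pderiv (Sum.inr i) (act A (eVec n)) = _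
        rw [act_eVec]
        simp [eVec, pderiv_X]
      · change pderiv (Sum.inr i) (act A (eDual n)) = _
        rw [act_eDual]
        simp [eDual, pderiv_X, Pi.single_apply, Finset.sum_ite_eq]
    rw [map_mul, pderiv_mul, hp, hX, Finset.sum_mul, Finset.mul_sum, ← Finset.sum_add_distrib]
    refine Finset.sum_congr rfl fun j _ => ?_
    rw [pderiv_mul, map_add, map_mul, map_mul]
    ring

lemma contraction_act (A : SL3) (p : Poly) : contraction (act A p) = act A (contraction p) := by
  have hA : ∀ l j : Fin 3, ∑ i, (A⁻¹).1 l i * A.1 i j = if l = j then 1 else 0 := by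
    intro l j
    have h : (A⁻¹ * A).1 l j = (1 : SL3).1 l j := by rw [inv_mul_cancel]
    rw [Matrix.SpecialLinearGroup.coe_mul, Matrix.mul_apply, Matrix.SpecialLinearGroup.coe_one,
      Matrix.one_apply] at h
    exact h
  simp only [contraction_apply, pderiv_inr_act, map_sum, pderiv_C_mul, pderiv_inl_act,
    Finset.mul_sum, ← mul_assoc, ← C_mul]
  rw [Finset.sum_comm]
  refine Finset.sum_congr rfl fun l _ => ?_
  rw [Finset.sum_comm]
  simp only [← Finset.sum_mul, ← map_sum, hA]
  simp

lemma act_homogeneous (A : SL3) {p : Poly} {n : ℕ × ℕ} (hp : IsWeightedHomogeneous bideg p n) :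
    IsWeightedHomogeneous bideg (act A p) n := by
  have hX : ∀ s, IsWeightedHomogeneous bideg (act A (X s)) (bideg s) := by
    rintro (j | j)
    · change IsWeightedHomogeneous bideg (act A (eVec j)) _
      rw [act_eVec]
      exact IsWeightedHomogeneous.sum _ _ _ fun i _ =>
        (isWeightedHomogeneous_X ℂ bideg (Sum.inl i)).C_mul _
    · change IsWeightedHomogeneous bideg (act A (eDual j)) _
      rw [act_eDual]
      exact IsWeightedHomogeneous.sum _ _ _ fun i _ =>
        (isWeightedHomogeneous_X ℂ bideg (Sum.inr i)).C_mul _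
  rw [p.as_sum, map_sum]
  refine IsWeightedHomogeneous.sum _ _ _ fun d hd => ?_
  rw [← hp (mem_support_iff.mp hd), monomial_eq, map_mul, act_C, Finsupp.prod, map_prod,
    Finsupp.weight_apply, Finsupp.sum]
  refine IsWeightedHomogeneous.C_mul ?_ _
  refine IsWeightedHomogeneous.prod _ _ _ fun s _ => ?_
  rw [map_pow]
  exact (hX s).pow _

/-- The representation of `SL(3, ℂ)` on polynomials. -/
def polyRep : Representation ℂ SL3 Poly where
  toFun A := (act A).toLinearMap
  map_one' := by
    rw [act_one]
    rfl
  map_mul' A B := by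
    rw [act_mul]
    rfl

/-- The representation `Γ_{a,b}` of `SL(3, ℂ)`. -/
def gamRep (a b : ℕ) : Representation ℂ SL3 (Gam a b) :=
  polyRep.subrepresentation (Gam a b) fun A p hp =>
    ⟨act_homogeneous A hp.1, by
      change contraction (act A p) = 0
      rw [contraction_act, LinearMap.mem_ker.mp hp.2, map_zero]⟩

/-! ### The vectors -/

/-- The polynomial `(e₂^*)² (e₃^*)^{k-1}`. -/
def vPoly (k : ℕ) : Poly := eDual 1 ^ 2 * eDual 2 ^ (k - 1)

/-- The polynomial `e₂^{2k-1} (e₂ e₂^* - (2k+1) e₁ e₁^* + e₃ e₃^*)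
+ e₁^{2k-1} (-(1/k) e₁ e₁^* + e₂ e₂^* + e₃ e₃^*)`. -/
def w0Poly (k : ℕ) : Poly :=
  eVec 1 ^ (2 * k - 1) *
      (eVec 1 * eDual 1 - C (2 * (k : ℂ) + 1) * (eVec 0 * eDual 0) + eVec 2 * eDual 2) +
    eVec 0 ^ (2 * k - 1) *
      (C (-(1 / (k : ℂ))) * (eVec 0 * eDual 0) + eVec 1 * eDual 1 + eVec 2 * eDual 2)

lemma eVec_homogeneous (i : Fin 3) : IsWeightedHomogeneous bideg (eVec i) (1, 0) :=
  isWeightedHomogeneous_X ℂ bideg (Sum.inl i)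

lemma eDual_homogeneous (i : Fin 3) : IsWeightedHomogeneous bideg (eDual i) (0, 1) :=
  isWeightedHomogeneous_X ℂ bideg (Sum.inr i)

lemma vPoly_mem {k : ℕ} (hk : 1 ≤ k) : vPoly k ∈ Gam 0 (k + 1) := by
  constructor
  · have h := ((eDual_homogeneous 1).pow 2).mul ((eDual_homogeneous 2).pow (k - 1))
    have e1 : 2 • ((0, 1) : ℕ × ℕ) + (k - 1) • ((0, 1) : ℕ × ℕ) = (0, k + 1) := by
      simp
      omega
    rw [e1] at h
    exact h
  · change contraction _ = 0
    rw [contraction_apply]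
    simp [vPoly, eDual, pderiv_X, Pi.single_apply, Fin.sum_univ_three]
    exact (pderiv (Sum.inl 1)).map_natCast 2

lemma w0Poly_mem {k : ℕ} (hk : 1 ≤ k) : w0Poly k ∈ Gam (2 * k) 1 := by
  constructor
  · have hq : ∀ i, IsWeightedHomogeneous bideg (eVec i * eDual i) ((1, 0) + (0, 1)) := fun i =>
      (eVec_homogeneous i).mul (eDual_homogeneous i)
    have e1 : (2 * k - 1) • ((1, 0) : ℕ × ℕ) + ((1, 0) + (0, 1)) = (2 * k, 1) := by
      simp
      omega
    have h := (((eVec_homogeneous 1).pow (2 * k - 1)).mul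
      (((hq 1).sub ((hq 0).C_mul (2 * (k : ℂ) + 1))).add (hq 2))).add
      (((eVec_homogeneous 0).pow (2 * k - 1)).mul
        ((((hq 0).C_mul (-(1 / (k : ℂ)))).add (hq 1)).add (hq 2)))
    rw [e1] at h
    exact h
  · have hk' : (k : ℂ) ≠ 0 := by exact_mod_cast (by omega : k ≠ 0)
    obtain ⟨n, hn⟩ : ∃ n, 2 * k - 1 = n + 1 := ⟨2 * k - 2, by omega⟩
    have hn' : (n : ℂ) = 2 * k - 2 := by
      have : ((n + 2 : ℕ) : ℂ) = ((2 * k : ℕ) : ℂ) := by congr 1; omega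
      push_cast at this
      linear_combination this
    have hC : (n : Poly) = C (2 * (k : ℂ) - 2) := by rw [← hn', map_natCast]
    change contraction _ = 0
    rw [contraction_apply]
    simp only [w0Poly, eVec, eDual, hn, Fin.sum_univ_three, map_add, map_sub, pderiv_mul, pderiv_pow,
      pderiv_C, pderiv_X]
    simp
    rw [hC]
    have h1 : (C (k : ℂ)⁻¹ : Poly) * C (k : ℂ) = 1 := by
      rw [← C_mul, inv_mul_cancel₀ hk', C_1]
    have h2 : (k : Poly) = C (k : ℂ) := by rw [map_natCast]
    simp only [map_sub, map_mul, map_ofNat, h2] at h1 ⊢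
    linear_combination (-2) * X (Sum.inl 0) ^ n * X (Sum.inl 0) * h1

/-- The vector `v` of `V = Γ_{0,k+1}`. -/
def vVec (k : ℕ) (hk : 1 ≤ k) : Gam 0 (k + 1) := ⟨vPoly k, vPoly_mem hk⟩

/-- The vector `w₀` of `W = Γ_{2k,1}`. -/
def w0Vec (k : ℕ) (hk : 1 ≤ k) : Gam (2 * k) 1 := ⟨w0Poly k, w0Poly_mem hk⟩

/-- The linear functional `l₃(a₁ L₁ + a₂ L₂ + a₃ L₃) = a₁ + a₂ - 2 a₃` on the weights
`a₁ L₁ + a₂ L₂` of the standard torus. -/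
def l3 (a : Fin 2 → ℤ) : ℤ := a 0 + a 1

/-- The sum `W'` of the weight spaces of `W = Γ_{2k,1}` for the weights `σ` of the standard torus
with `l₃(σ) ≤ 2k - 7`. -/
def Wprime (k : ℕ) : Submodule ℂ (Gam (2 * k) 1) :=
  ⨆ (a : Fin 2 → ℤ) (_ : l3 a ≤ 2 * (k : ℤ) - 7), weightSpace (gamRep (2 * k) 1) stdTorus a

/-- `P x` holds for generic `x` in the vector space `E`: on the nonempty Zariski open set where
some polynomial function on `E`, not identically zero, does not vanish. Polynomial functions are
written as polynomials in linear functionals. -/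
def Generically {E : Type} [AddCommGroup E] [Module ℂ E] (P : E → Prop) : Prop :=
  ∃ F : MvPolynomial (Module.Dual ℂ E) ℂ,
    (∃ x : E, MvPolynomial.eval (fun φ : Module.Dual ℂ E => φ x) F ≠ 0) ∧
      ∀ x : E, MvPolynomial.eval (fun φ : Module.Dual ℂ E => φ x) F ≠ 0 → P x

end PairStability

end

open PairStability

noncomputable section

namespace PairStability

section WeightTheory

variable {V W : Type} [AddCommGroup V] [Module ℂ V] [AddCommGroup W] [Module ℂ W] {r : ℕ}

/-- The character `t ↦ t₁^{a₁} ⋯ t_r^{a_r}`. -/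
def character (a : Fin r → ℤ) : (Fin r → ℂˣ) →* ℂ where
  toFun t := ((∏ l, t l ^ a l : ℂˣ) : ℂ)
  map_one' := by simp
  map_mul' s t := by simp [mul_zpow, Finset.prod_mul_distrib]

lemma character_apply (a : Fin r → ℤ) (t : Fin r → ℂˣ) :
    character a t = ((∏ l, t l ^ a l : ℂˣ) : ℂ) := rfl

lemma character_add (a b : Fin r → ℤ) (t : Fin r → ℂˣ) :
    character (a + b) t = character a t * character b t := by
  simp [character_apply, zpow_add, Finset.prod_mul_distrib]

lemma character_sum {ι : Type*} (s : Finset ι) (a : ι → Fin r → ℤ) (t : Fin r → ℂˣ) :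
    character (∑ i ∈ s, a i) t = ∏ i ∈ s, character (a i) t := by
  classical
  induction s using Finset.induction_on with
  | empty => simp [character_apply]
  | insert i s hi ih => rw [Finset.sum_insert hi, Finset.prod_insert hi, character_add, ih]

lemma character_injective : Function.Injective (character (r := r)) := by
  intro a b h
  funext l
  have h2 : (2 : ℂ) ≠ 0 := two_ne_zero
  have key : ∀ c : Fin r → ℤ, character c (Pi.mulSingle l (Units.mk0 2 h2)) = (2 : ℂ) ^ c l := by
    intro c
    rw [character_apply, Finset.prod_eq_single l]
    · simp
    · intro j _ hj
      simp [Pi.mulSingle_eq_of_ne hj]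
    · simp
  have h1 := DFunLike.congr_fun h (Pi.mulSingle l (Units.mk0 2 h2))
  rw [key, key] at h1
  have h3 := congrArg norm h1
  rw [norm_zpow, norm_zpow] at h3
  exact zpow_right_injective₀ (by simp) (by simp) h3

lemma linearIndependent_character :
    LinearIndependent ℂ fun a : Fin r → ℤ => (character a : (Fin r → ℂˣ) → ℂ) :=
  (linearIndependent_monoidHom (Fin r → ℂˣ) ℂ).comp _ character_injective

lemma finsupp_eq_zero_of_character_sum (f : (Fin r → ℤ) →₀ V)
    (h : ∀ t, (f.sum fun a y => character a t • y) = 0) : f = 0 := by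
  have hφ : ∀ φ : Module.Dual ℂ V, f.mapRange φ (map_zero φ) = 0 := by
    intro φ
    refine linearIndependent_iff.mp linearIndependent_character _ ?_
    funext t
    have h1 := congrArg φ (h t)
    rw [Finsupp.sum, map_sum, map_zero] at h1
    rw [Finsupp.linearCombination_apply, Finsupp.sum_mapRange_index (by simp), Finsupp.sum,
      Finset.sum_apply, Pi.zero_apply, ← h1]
    refine Finset.sum_congr rfl fun a _ => ?_
    simp [mul_comm]
  ext a
  rw [Finsupp.zero_apply]
  refine (Module.forall_dual_apply_eq_zero_iff ℂ (f a)).mp fun φ => ?_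
  simpa using DFunLike.congr_fun (hφ φ) a

/-- `f` is a decomposition of `x` into weight vectors. -/
def IsWeightDecomp (ρ : Representation ℂ SL3 V) (χ : (Fin r → ℂˣ) →* SL3) (x : V)
    (f : (Fin r → ℤ) →₀ V) : Prop :=
  (∀ b, f b ∈ weightSpace ρ χ b) ∧ (f.sum fun _ y => y) = x

lemma mem_weightSpace {ρ : Representation ℂ SL3 V} {χ : (Fin r → ℂˣ) →* SL3} {a : Fin r → ℤ}
    {x : V} : x ∈ weightSpace ρ χ a ↔ ∀ t, ρ (χ t) x = character a t • x := Iff.rfl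

lemma IsWeightDecomp.apply {ρ : Representation ℂ SL3 V} {χ : (Fin r → ℂˣ) →* SL3} {x : V}
    {f : (Fin r → ℤ) →₀ V} (h : IsWeightDecomp ρ χ x f) (t : Fin r → ℂˣ) :
    ρ (χ t) x = f.sum fun a y => character a t • y := by
  rw [← h.2, Finsupp.sum, map_sum]
  exact Finset.sum_congr rfl fun a _ => mem_weightSpace.mp (h.1 a) t

lemma IsWeightDecomp.unique {ρ : Representation ℂ SL3 V} {χ : (Fin r → ℂˣ) →* SL3} {x : V}
    {f g : (Fin r → ℤ) →₀ V} (hf : IsWeightDecomp ρ χ x f) (hg : IsWeightDecomp ρ χ x g) :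
    f = g := by
  rw [← sub_eq_zero]
  refine finsupp_eq_zero_of_character_sum _ fun t => ?_
  rw [Finsupp.sum_sub_index (by intros; rw [smul_sub]), ← hf.apply, ← hg.apply, sub_self]

lemma IsWeightDecomp.weights_eq {ρ : Representation ℂ SL3 V} {χ : (Fin r → ℂˣ) →* SL3} {x : V}
    {f : (Fin r → ℤ) →₀ V} (hf : IsWeightDecomp ρ χ x f) : weights ρ χ x = f.support := by
  ext a
  rw [Finset.mem_coe, Finsupp.mem_support_iff]
  constructor
  · rintro ⟨g, hg, hx, ha⟩
    rwa [hf.unique ⟨hg, hx⟩]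
  · exact fun ha => ⟨f, hf.1, hf.2, ha⟩

lemma isWeightDecomp_sum {ι : Type*} {ρ : Representation ℂ SL3 V} {χ : (Fin r → ℂˣ) →* SL3}
    (s : Finset ι) (z : ι → V) (β : ι → Fin r → ℤ)
    (h : ∀ i ∈ s, z i ∈ weightSpace ρ χ (β i)) :
    IsWeightDecomp ρ χ (∑ i ∈ s, z i) (∑ i ∈ s, Finsupp.single (β i) (z i)) := by
  classical
  constructor
  · intro b
    rw [Finsupp.finsetSum_apply]
    refine Submodule.sum_mem _ fun i hi => ?_
    rw [Finsupp.single_apply]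
    split_ifs with hb
    · exact hb ▸ h i hi
    · exact Submodule.zero_mem _
  · rw [← Finsupp.sum_finsetSum_index (by simp) (by simp)]
    exact Finset.sum_congr rfl fun i _ => Finsupp.sum_single_index rfl

/-- A decomposition of a vector of an invariant subspace lies in the subspace. -/
lemma IsWeightDecomp.mem_of_invariant {ρ : Representation ℂ SL3 V} {χ : (Fin r → ℂˣ) →* SL3}
    {x : V} {f : (Fin r → ℤ) →₀ V} (hf : IsWeightDecomp ρ χ x f) (S : Submodule ℂ V)
    (hS : ∀ A, ∀ y ∈ S, ρ A y ∈ S) (hx : x ∈ S) (a : Fin r → ℤ) : f a ∈ S := by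
  have h0 : f.mapRange S.mkQ (map_zero _) = 0 := by
    refine finsupp_eq_zero_of_character_sum _ fun t => ?_
    rw [Finsupp.sum_mapRange_index (by simp)]
    have h1 := (Submodule.Quotient.mk_eq_zero S).mpr (hS (χ t) x hx)
    rw [hf.apply, ← Submodule.mkQ_apply, Finsupp.sum, map_sum] at h1
    simpa [Finsupp.sum] using h1
  have h2 := DFunLike.congr_fun h0 a
  rwa [Finsupp.mapRange_apply, Finsupp.zero_apply, Submodule.mkQ_apply,
    Submodule.Quotient.mk_eq_zero] at h2

lemma IsWeightDecomp.subrepresentation {ρ : Representation ℂ SL3 V} {χ : (Fin r → ℂˣ) →* SL3}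
    (S : Submodule ℂ V) (hS : ∀ A, ∀ y ∈ S, ρ A y ∈ S) (x : S)
    {f : (Fin r → ℤ) →₀ V} (hf : IsWeightDecomp ρ χ (x : V) f) :
    ∃ g : (Fin r → ℤ) →₀ S, IsWeightDecomp (ρ.subrepresentation S hS) χ x g ∧
      g.support = f.support := by
  have hmem := hf.mem_of_invariant S hS x.2
  refine ⟨Finsupp.onFinset f.support (fun a => ⟨f a, hmem a⟩) fun a ha => ?_, ⟨fun b t => ?_, ?_⟩,
    ?_⟩
  · rw [Finsupp.mem_support_iff]
    exact fun h => ha (Subtype.ext h)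
  · exact Subtype.ext (hf.1 b t)
  · apply Subtype.ext
    rw [Finsupp.onFinset_sum _ (by simp), AddSubmonoidClass.coe_finsetSum]
    exact hf.2
  · ext a
    simp

end WeightTheory

section Polytopes

variable {V W : Type} [AddCommGroup V] [Module ℂ V] [AddCommGroup W] [Module ℂ W] {r : ℕ}

lemma mem_weightSpace_conj {n : ℕ} (ρ : Representation ℂ SL3 V) {χ : (Fin r → ℂˣ) →* SL3}
    {χ' : (Fin n → ℂˣ) →* SL3} {g : SL3} {ψ : (Fin r → ℂˣ) → Fin n → ℂˣ}
    (hχ : ∀ t, χ t = g * χ' (ψ t) * g⁻¹) {N : (Fin n → ℤ) → Fin r → ℤ}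
    (hN : ∀ a t, character (N a) t = character a (ψ t)) {a : Fin n → ℤ} {y : V}
    (hy : y ∈ weightSpace ρ χ' a) : ρ g y ∈ weightSpace ρ χ (N a) := by
  intro t
  rw [← character_apply, hN, ← Module.End.mul_apply, ← map_mul, hχ, inv_mul_cancel_right, map_mul,
    Module.End.mul_apply, mem_weightSpace.mp hy, map_smul]

/-- The weights for a conjugate torus. -/
lemma IsWeightDecomp.conj {n : ℕ} {ρ : Representation ℂ SL3 V} {χ : (Fin r → ℂˣ) →* SL3}
    {χ' : (Fin n → ℂˣ) →* SL3} {g : SL3} {ψ : (Fin r → ℂˣ) → Fin n → ℂˣ}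
    (hχ : ∀ t, χ t = g * χ' (ψ t) * g⁻¹) {N : (Fin n → ℤ) → Fin r → ℤ}
    (hN : ∀ a t, character (N a) t = character a (ψ t)) (hinj : Function.Injective N) {x : V}
    {f : (Fin n → ℤ) →₀ V} (hf : IsWeightDecomp ρ χ' (ρ g⁻¹ x) f) :
    ∃ h, IsWeightDecomp ρ χ x h ∧ (h.support : Set (Fin r → ℤ)) = N '' f.support := by
  have hg : ∀ y, ρ g y = 0 ↔ y = 0 := fun y => by
    refine ⟨fun h => ?_, fun h => by rw [h, map_zero]⟩
    rw [← ρ.inv_self_apply g y, h, map_zero]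
  refine ⟨(f.mapRange (ρ g) (map_zero _)).embDomain ⟨N, hinj⟩, ⟨fun b => ?_, ?_⟩, ?_⟩
  · by_cases hb : b ∈ Set.range N
    · obtain ⟨a, rfl⟩ := hb
      have h1 := Finsupp.embDomain_apply_self ⟨N, hinj⟩ (f.mapRange (ρ g) (map_zero _)) a
      rw [Function.Embedding.coeFn_mk] at h1
      rw [h1, Finsupp.mapRange_apply]
      exact mem_weightSpace_conj ρ hχ hN (hf.1 a)
    · rw [Finsupp.embDomain_of_notMem_range _ _ _ hb]
      exact Submodule.zero_mem _
  · rw [Finsupp.embDomain_eq_mapDomain, Finsupp.sum_mapDomain_index (by simp) (by simp),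
      Finsupp.sum_mapRange_index (by simp), Finsupp.sum, ← map_sum]
    have h2 := hf.2
    rw [Finsupp.sum] at h2
    rw [h2, ρ.self_inv_apply]
  · ext b
    simp [Finsupp.support_embDomain, hg]

lemma weightPolytope_subset {ρ : Representation ℂ SL3 V} {τ : Representation ℂ SL3 W}
    {χ : (Fin r → ℂˣ) →* SL3} {v : V} {w : W} (hfin : (weights τ χ w).Finite)
    (h : ∀ L : (Fin r → ℝ) →ₗ[ℝ] ℝ, ∃ a ∈ weights τ χ w, ∀ b ∈ weights ρ χ v,
      L (toReal b) ≤ L (toReal a)) :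
    weightPolytope ρ χ v ⊆ weightPolytope τ χ w := by
  refine convexHull_min ?_ (convex_convexHull ℝ _)
  rintro _ ⟨b, hb, rfl⟩
  by_contra hb'
  obtain ⟨f, u, hu, hfu⟩ := geometric_hahn_banach_closed_point (convex_convexHull ℝ _)
    ((hfin.image toReal).isClosed_convexHull ℝ) hb'
  obtain ⟨a, ha, hab⟩ := h f.toLinearMap
  have h1 := hu _ (subset_convexHull ℝ _ ⟨a, ha, rfl⟩)
  have h2 := hab b hb
  exact absurd (h1.trans hfu) (not_lt.mpr h2)

lemma mem_support_sum_single {M ι : Type*} [AddCommMonoid M] {s : Finset ι} {z : ι → M} {β : ι → Fin r → ℤ}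
    {a : Fin r → ℤ} (ha : a ∈ (∑ i ∈ s, Finsupp.single (β i) (z i)).support) :
    ∃ i ∈ s, β i = a := by
  classical
  by_contra! h
  rw [Finsupp.mem_support_iff, Finsupp.finsetSum_apply] at ha
  exact ha (Finset.sum_eq_zero fun i hi => Finsupp.single_eq_of_ne (h i hi).symm)

lemma IsWeightDecomp.tmul {ρ : Representation ℂ SL3 V} {τ : Representation ℂ SL3 W}
    {χ : (Fin r → ℂˣ) →* SL3} {x : V} {y : W} {f : (Fin r → ℤ) →₀ V} {g : (Fin r → ℤ) →₀ W}
    (hf : IsWeightDecomp ρ χ x f) (hg : IsWeightDecomp τ χ y g) :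
    ∃ h, IsWeightDecomp (ρ.tprod τ) χ (x ⊗ₜ[ℂ] y) h ∧
      ∀ a ∈ h.support, ∃ b ∈ f.support, ∃ c ∈ g.support, b + c = a := by
  have h1 := isWeightDecomp_sum (ρ := ρ.tprod τ) (χ := χ) (f.support ×ˢ g.support)
    (fun p => f p.1 ⊗ₜ[ℂ] g p.2) (fun p => p.1 + p.2) (by
      rintro ⟨a, b⟩ _ t
      rw [← character_apply, character_add, Representation.tprod_apply, TensorProduct.map_tmul,
        mem_weightSpace.mp (hf.1 a), mem_weightSpace.mp (hg.1 b), TensorProduct.smul_tmul_smul])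
  have h2 : ∑ p ∈ f.support ×ˢ g.support, f p.1 ⊗ₜ[ℂ] g p.2 = x ⊗ₜ[ℂ] y := by
    rw [Finset.sum_product, ← hf.2, ← hg.2, Finsupp.sum, Finsupp.sum, TensorProduct.sum_tmul]
    refine Finset.sum_congr rfl fun a _ => ?_
    rw [TensorProduct.tmul_sum]
  rw [h2] at h1
  refine ⟨_, h1, fun a ha => ?_⟩
  obtain ⟨p, hp, rfl⟩ := mem_support_sum_single ha
  rw [Finset.mem_product] at hp
  exact ⟨p.1, hp.1, p.2, hp.2, rfl⟩

lemma IsWeightDecomp.linearIndependent {ρ : Representation ℂ SL3 V} {χ : (Fin r → ℂˣ) →* SL3}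
    {x : V} {f : (Fin r → ℤ) →₀ V} (hf : IsWeightDecomp ρ χ x f) :
    LinearIndependent ℂ fun b : f.support => f b := by
  classical
  rw [linearIndependent_iff']
  intro s c hc i hi
  have h1 := isWeightDecomp_sum (ρ := ρ) (χ := χ) s (fun b => c b • f b) (fun b => (b : Fin r → ℤ))
    fun b _ => Submodule.smul_mem _ _ (hf.1 b)
  rw [hc] at h1
  have h2 : IsWeightDecomp ρ χ (0 : V) 0 := ⟨fun b => Submodule.zero_mem _, Finsupp.sum_zero_index⟩
  have h3 := DFunLike.congr_fun (h1.unique h2) (i : Fin r → ℤ)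
  rw [Finsupp.finsetSum_apply, Finset.sum_eq_single i] at h3
  · rw [Finsupp.single_eq_same, Finsupp.zero_apply, smul_eq_zero] at h3
    exact h3.resolve_right (Finsupp.mem_support_iff.mp i.2)
  · intro b _ hb
    exact Finsupp.single_eq_of_ne fun h => hb (Subtype.ext h.symm)
  · exact fun h => absurd hi h

lemma IsWeightDecomp.exists_dual {ρ : Representation ℂ SL3 V} {χ : (Fin r → ℂˣ) →* SL3}
    {x : V} {f : (Fin r → ℤ) →₀ V} (hf : IsWeightDecomp ρ χ x f) {a : Fin r → ℤ}
    (ha : a ∈ f.support) :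
    ∃ φ : Module.Dual ℂ V, φ (f a) = 1 ∧ ∀ b, b ≠ a → φ (f b) = 0 := by
  classical
  obtain ⟨g, hg⟩ := (Finsupp.linearCombination ℂ fun b : f.support => f b).exists_leftInverse_of_injective
    (LinearMap.ker_eq_bot.mpr hf.linearIndependent)
  have hg' : ∀ b : f.support, g (f b) = Finsupp.single b 1 := fun b => by
    have := LinearMap.congr_fun hg (Finsupp.single b 1)
    simpa using this
  refine ⟨Finsupp.lapply ⟨a, ha⟩ ∘ₗ g, ?_, fun b hb => ?_⟩
  · have := hg' ⟨a, ha⟩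
    simp [this]
  · by_cases hb' : b ∈ f.support
    · have h1 := hg' ⟨b, hb'⟩
      rw [LinearMap.comp_apply, h1, Finsupp.lapply_apply]
      exact Finsupp.single_eq_of_ne fun h => hb (congrArg Subtype.val h).symm
    · rw [Finsupp.notMem_support_iff.mp hb', map_zero]

/-- The weights of a tensor power of a vector are sums of weights of the vector, and contain the
multiples of these. -/
lemma IsWeightDecomp.vecPow {ρ : Representation ℂ SL3 V} {χ : (Fin r → ℂˣ) →* SL3} {x : V}
    {f : (Fin r → ℤ) →₀ V} (hf : IsWeightDecomp ρ χ x f) (m : ℕ) :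
    ∃ h, IsWeightDecomp (tensorPow ρ m) χ (vecPow x m) h ∧
      (∀ a ∈ h.support, ∃ s : Fin m → Fin r → ℤ, (∀ i, s i ∈ f.support) ∧ ∑ i, s i = a) ∧
      ∀ a ∈ f.support, m • a ∈ h.support := by
  classical
  have h1 := isWeightDecomp_sum (ρ := tensorPow ρ m) (χ := χ)
    (Fintype.piFinset fun _ : Fin m => f.support)
    (fun s => PiTensorProduct.tprod ℂ fun i => f (s i)) (fun s => ∑ i, s i) (by
      intro s _ t
      rw [← character_apply, character_sum]
      change PiTensorProduct.map (fun _ => ρ (χ t)) _ = _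
      rw [PiTensorProduct.map_tprod, ← MultilinearMap.map_smul_univ]
      exact congrArg _ (funext fun i => mem_weightSpace.mp (hf.1 (s i)) t))
  have h2 : ∑ s ∈ Fintype.piFinset fun _ : Fin m => f.support,
      PiTensorProduct.tprod ℂ (fun i => f (s i)) = PairStability.vecPow x m := by
    rw [PairStability.vecPow, ← hf.2, Finsupp.sum, MultilinearMap.map_sum_finset]
  rw [h2] at h1
  refine ⟨_, h1, fun a ha => ?_, fun a ha => ?_⟩
  · obtain ⟨s, hs, rfl⟩ := mem_support_sum_single ha
    exact ⟨s, fun i => Fintype.mem_piFinset.mp hs i, rfl⟩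
  · obtain ⟨φ, hφ, hφ'⟩ := hf.exists_dual ha
    rw [Finsupp.mem_support_iff]
    intro h0
    have h3 := congrArg (PiTensorProduct.lift
      ((MultilinearMap.mkPiAlgebra ℂ (Fin m) ℂ).compLinearMap fun _ => φ)) h0
    rw [Finsupp.finsetSum_apply, map_sum, map_zero, Finset.sum_eq_single fun _ => a] at h3
    · rw [show ∑ _i : Fin m, a = m • a by simp, Finsupp.single_eq_same, PiTensorProduct.lift.tprod] at h3
      simp [hφ] at h3
    · intro s _ hs
      rw [Finsupp.single_apply]
      split_ifs
      · obtain ⟨i, hi⟩ : ∃ i, s i ≠ a := by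
          by_contra! h
          exact hs (funext h)
        rw [PiTensorProduct.lift.tprod]
        simp only [MultilinearMap.compLinearMap_apply, MultilinearMap.mkPiAlgebra_apply]
        exact Finset.prod_eq_zero (Finset.mem_univ i) (hφ' _ hi)
      · exact map_zero _
    · intro h
      exact absurd (Fintype.mem_piFinset.mpr fun _ => ha) h

end Polytopes

section Tori

variable {r : ℕ}

lemma stdRep_apply (A : SL3) (x : Fin 3 → ℂ) : stdRep A x = A.1.mulVec x := rfl

/-- Under an algebraic torus, each vector of `ℂ³` is a sum of weight vectors. -/
lemma exists_isWeightDecomp_stdRep {χ : (Fin r → ℂˣ) →* SL3} (hχ : IsTorusParam χ)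
    (x : Fin 3 → ℂ) : ∃ f, IsWeightDecomp stdRep χ x f := by
  choose c hc using hχ.2
  let f : (Fin r → ℤ) →₀ (Fin 3 → ℂ) :=
    ∑ i, ∑ j, (c i j).mapRange (fun z => Pi.single i (z * x j)) (by simp)
  have hf : ∀ t, stdRep (χ t) x = f.sum fun a y => character a t • y := by
    intro t
    have h1 : ∀ i, (∑ j, (c i j).mapRange (fun z => Pi.single i (z * x j))
        (by simp)).sum (fun a y => character a t • y) =
        (Pi.single i ((χ t).1.mulVec x i) : Fin 3 → ℂ) := by
      intro i
      rw [← Finsupp.sum_finsetSum_index (by simp) (by simp)]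
      rw [Matrix.mulVec, dotProduct]
      rw [← Finset.univ_sum_single (Pi.single i (∑ j, (χ t).1 i j * x j) : Fin 3 → ℂ)]
      funext m
      rw [Finset.sum_apply, Finset.univ_sum_single]
      by_cases hm : m = i
      · subst hm
        rw [Pi.single_eq_same]
        refine Finset.sum_congr rfl fun j _ => ?_
        rw [Finsupp.sum_mapRange_index (by simp), hc, Finsupp.sum, Finsupp.sum, Finset.sum_apply,
          Finset.sum_mul]
        refine Finset.sum_congr rfl fun a _ => ?_
        rw [Pi.smul_apply, Pi.single_eq_same, smul_eq_mul, character_apply]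
        ring
      · rw [Pi.single_eq_of_ne hm]
        refine Finset.sum_eq_zero fun j _ => ?_
        rw [Finsupp.sum_mapRange_index (by simp), Finsupp.sum, Finset.sum_apply]
        refine Finset.sum_eq_zero fun a _ => ?_
        rw [Pi.smul_apply, Pi.single_eq_of_ne hm, smul_zero]
    rw [stdRep_apply, ← Finsupp.sum_finsetSum_index (by simp) (by simp)]
    simp only [h1]
    rw [Finset.univ_sum_single]
  refine ⟨f, fun a s => ?_, ?_⟩
  · let g : (Fin r → ℤ) →₀ (Fin 3 → ℂ) :=
      Finsupp.onFinset f.support (fun a => stdRep (χ s) (f a) - character a s • f a) fun a ha => by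
        rw [Finsupp.mem_support_iff]
        intro h0
        simp [h0] at ha
    have hg : g = 0 := by
      refine finsupp_eq_zero_of_character_sum g fun t => ?_
      rw [Finsupp.onFinset_sum _ (by simp)]
      have h3 := hf (s * t)
      rw [map_mul, map_mul, Module.End.mul_apply, hf t, Finsupp.sum, map_sum, Finsupp.sum,
        ← sub_eq_zero, ← Finset.sum_sub_distrib] at h3
      rw [← h3]
      refine Finset.sum_congr rfl fun a _ => ?_
      rw [map_smul, map_mul, smul_sub, smul_smul, mul_comm]
    have h4 := DFunLike.congr_fun hg a
    exact sub_eq_zero.mp h4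
  · have h1 := hf 1
    simp only [map_one, Module.End.one_apply, one_smul] at h1
    exact h1.symm

lemma exists_weight_basis {χ : (Fin r → ℂˣ) →* SL3} (hχ : IsTorusParam χ) :
    ∃ (b : Module.Basis (Fin 3) ℂ (Fin 3 → ℂ)) (a : Fin 3 → Fin r → ℤ),
      ∀ i, b i ∈ weightSpace stdRep χ (a i) := by
  have hspan : ⊤ ≤ Submodule.span ℂ (⋃ a, (weightSpace stdRep χ a : Set (Fin 3 → ℂ))) := by
    rintro x -
    obtain ⟨f, hf, rfl⟩ := exists_isWeightDecomp_stdRep hχ x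
    exact Submodule.sum_mem _ fun a _ => Submodule.subset_span (Set.mem_iUnion.mpr ⟨a, hf a⟩)
  let b₀ := Module.Basis.ofSpan hspan
  have := Module.Finite.finite_basis b₀
  have := Fintype.ofFinite ((linearIndepOn_empty ℂ id).extend
    (Set.empty_subset (⋃ a, (weightSpace stdRep χ a : Set (Fin 3 → ℂ)))))
  have hcard := Module.finrank_eq_card_basis b₀
  rw [Module.finrank_fin_fun] at hcard
  let b := b₀.reindex (Fintype.equivFinOfCardEq hcard.symm)
  have hb : ∀ i, ∃ a, b i ∈ weightSpace stdRep χ a := fun i => by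
    have h1 : b i ∈ Set.range b₀ := by
      rw [Module.Basis.reindex_apply]
      exact Set.mem_range_self _
    exact Set.mem_iUnion.mp (Module.Basis.ofSpan_subset hspan h1)
  choose a ha using hb
  exact ⟨b, a, ha⟩

lemma exists_diagonalizing {χ : (Fin r → ℂˣ) →* SL3} (hχ : IsTorusParam χ) :
    ∃ (g : SL3) (a : Fin 3 → Fin r → ℤ), ∀ t,
      (χ t).1 * g.1 = g.1 * Matrix.diagonal fun i => character (a i) t := by
  obtain ⟨b, a, hb⟩ := exists_weight_basis hχ
  let M : Matrix (Fin 3) (Fin 3) ℂ := Matrix.of fun i j => b j i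
  have hM : M.det ≠ 0 := by
    have h1 : LinearIndependent ℂ M.col := b.linearIndependent
    rw [Matrix.linearIndependent_cols_iff_isUnit, Matrix.isUnit_iff_isUnit_det] at h1
    exact h1.ne_zero
  have hM' : ∀ t, (χ t).1 * M = M * Matrix.diagonal fun i => character (a i) t := by
    intro t
    ext i j
    rw [Matrix.mul_diagonal]
    have := congrFun (hb j t) i
    rw [stdRep_apply, Pi.smul_apply, smul_eq_mul, mul_comm] at this
    exact this
  let D : Matrix (Fin 3) (Fin 3) ℂ := Matrix.diagonal ![M.det⁻¹, 1, 1]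
  refine ⟨⟨M * D, ?_⟩, a, fun t => ?_⟩
  · rw [Matrix.det_mul, Matrix.det_diagonal, Fin.prod_univ_three]
    simp [hM]
  · change (χ t).1 * (M * D) = M * D * _
    rw [← mul_assoc, hM', mul_assoc, mul_assoc]
    congr 1
    rw [Matrix.diagonal_mul_diagonal, Matrix.diagonal_mul_diagonal]
    exact congrArg _ (funext fun i => mul_comm _ _)

lemma stdTorus_val (t : Fin 2 → ℂˣ) : (stdTorus t).1 =
    Matrix.diagonal ![(t 0 : ℂ), (t 1 : ℂ), ((t 0)⁻¹ * (t 1)⁻¹ : ℂˣ)] := rfl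

lemma stdTorus_injective : Function.Injective stdTorus := by
  intro s t h
  have h1 := congrArg Subtype.val h
  rw [stdTorus_val, stdTorus_val, Matrix.diagonal_eq_diagonal_iff] at h1
  funext i
  fin_cases i
  · exact Units.ext (h1 0)
  · exact Units.ext (h1 1)

lemma isTorus_conj_stdTorus (g : SL3) :
    IsTorus ((MulAut.conj g).toMonoidHom.comp stdTorus).range := by
  refine ⟨2, _, ⟨(MulAut.conj g).injective.comp stdTorus_injective, fun i j => ?_⟩, rfl⟩
  refine ⟨Finsupp.single ![1, 0] (g.1 i 0 * (g⁻¹).1 0 j) +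
    Finsupp.single ![0, 1] (g.1 i 1 * (g⁻¹).1 1 j) +
    Finsupp.single ![-1, -1] (g.1 i 2 * (g⁻¹).1 2 j), fun t => ?_⟩
  rw [Finsupp.sum_add_index' (by simp) (by intros; ring),
    Finsupp.sum_add_index' (by simp) (by intros; ring), Finsupp.sum_single_index (by simp),
    Finsupp.sum_single_index (by simp), Finsupp.sum_single_index (by simp)]
  change (g.1 * (stdTorus t).1 * (g⁻¹).1) i j = _
  rw [stdTorus_val, Matrix.mul_apply, Fin.sum_univ_three]
  simp only [Matrix.mul_diagonal, Fin.prod_univ_two]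
  simp
  ring

/-- A maximal torus is conjugate to the standard torus. -/
lemma exists_conj_stdTorus {χ : (Fin r → ℂˣ) →* SL3} (hχ : IsTorusParam χ)
    (hmax : Maximal IsTorus χ.range) :
    ∃ (g : SL3) (ψ : (Fin r → ℂˣ) → Fin 2 → ℂˣ) (N : (Fin 2 → ℤ) → Fin r → ℤ),
      (∀ t, χ t = g * stdTorus (ψ t) * g⁻¹) ∧
        (∀ a t, character (N a) t = character a (ψ t)) ∧ Function.Injective N ∧
          ∀ a b, N (a + b) = N a + N b := by
  obtain ⟨g, a, hg⟩ := exists_diagonalizing hχ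
  let ψ : (Fin r → ℂˣ) → Fin 2 → ℂˣ := fun t => ![∏ l, t l ^ a 0 l, ∏ l, t l ^ a 1 l]
  let N : (Fin 2 → ℤ) → Fin r → ℤ := fun e => e 0 • a 0 + e 1 • a 1
  have hψ : ∀ t, χ t = g * stdTorus (ψ t) * g⁻¹ := by
    intro t
    rw [eq_mul_inv_iff_mul_eq]
    apply Subtype.ext
    rw [Matrix.SpecialLinearGroup.coe_mul, Matrix.SpecialLinearGroup.coe_mul, hg t, stdTorus_val]
    congr 2
    have hdet := congrArg Matrix.det (hg t)
    rw [Matrix.det_mul, Matrix.det_mul, (χ t).2, g.2, one_mul, one_mul, Matrix.det_diagonal,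
      Fin.prod_univ_three] at hdet
    have hdet' : (∏ l, t l ^ a 0 l) * (∏ l, t l ^ a 1 l) * ∏ l, t l ^ a 2 l = 1 := by
      apply Units.ext
      rw [Units.val_mul, Units.val_mul, Units.val_one]
      exact hdet.symm
    funext i
    fin_cases i
    · rfl
    · rfl
    · change ((∏ l, t l ^ a 2 l : ℂˣ) : ℂ) = ((∏ l, t l ^ a 0 l)⁻¹ * (∏ l, t l ^ a 1 l)⁻¹ : ℂˣ)
      rw [← mul_inv, eq_inv_of_mul_eq_one_right hdet']
  have hN : ∀ e t, character (N e) t = character e (ψ t) := by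
    intro e t
    rw [character_apply, character_apply, Fin.prod_univ_two]
    simp [ψ, N, zpow_add, Finset.prod_mul_distrib, zpow_mul, Finset.prod_zpow, mul_comm (e _)]
  refine ⟨g, ψ, N, hψ, hN, fun e e' he => ?_, fun e e' => ?_⟩
  · have hle : χ.range ≤ ((MulAut.conj g).toMonoidHom.comp stdTorus).range := by
      rintro _ ⟨t, rfl⟩
      exact ⟨ψ t, (hψ t).symm⟩
    have hge := hmax.2 (isTorus_conj_stdTorus g) hle
    apply character_injective
    refine MonoidHom.ext fun s => ?_
    obtain ⟨t, ht⟩ := hge ⟨s, rfl⟩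
    have h1 : stdTorus (ψ t) = stdTorus s := by
      rw [hψ] at ht
      exact (MulAut.conj g).injective ht
    rw [← stdTorus_injective h1, ← hN, ← hN, he]
  · simp only [N, Pi.add_apply, add_smul]
    abel

end Tori

section StandardWeights

/-- The weight of the basis vector `e_i` of `ℂ³`. -/
def stdWeight : Fin 3 → Fin 2 → ℤ := ![![1, 0], ![0, 1], ![-1, -1]]

/-- The weight of a monomial. -/
def monWeight (d : Fin 3 ⊕ Fin 3 →₀ ℕ) : Fin 2 → ℤ :=
  ∑ i, ((d (Sum.inl i) : ℤ) - d (Sum.inr i)) • stdWeight i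

lemma character_zsmul {r : ℕ} (n : ℤ) (a : Fin r → ℤ) (t : Fin r → ℂˣ) :
    character (n • a) t = character a t ^ n := by
  simp [character_apply, ← Finset.prod_zpow, zpow_mul, mul_comm n]

lemma stdTorus_apply (t : Fin 2 → ℂˣ) :
    (stdTorus t).1 = Matrix.diagonal fun i => character (stdWeight i) t := by
  rw [stdTorus_val]
  congr 1
  funext i
  rw [character_apply, Fin.prod_univ_two]
  fin_cases i <;> simp [stdWeight]

lemma character_neg {r : ℕ} (a : Fin r → ℤ) (t : Fin r → ℂˣ) :
    character a t⁻¹ = (character a t)⁻¹ := by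
  simp [character_apply]

lemma character_ne_zero {r : ℕ} (a : Fin r → ℤ) (t : Fin r → ℂˣ) : character a t ≠ 0 :=
  Units.ne_zero _

lemma act_stdTorus_X (t : Fin 2 → ℂˣ) (s : Fin 3 ⊕ Fin 3) :
    act (stdTorus t) (X s) =
      C (Sum.elim (fun i => character (stdWeight i) t) (fun i => (character (stdWeight i) t)⁻¹) s) *
        X s := by
  rcases s with i | i
  · change act _ (eVec i) = _
    rw [act_eVec, stdTorus_apply, Finset.sum_eq_single i]
    · rw [Matrix.diagonal_apply_eq]
      rfl
    · intro j _ hj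
      rw [Matrix.diagonal_apply_ne _ hj, C_0, zero_mul]
    · simp
  · change act _ (eDual i) = _
    rw [act_eDual, ← map_inv, stdTorus_apply, Finset.sum_eq_single i]
    · rw [Matrix.diagonal_apply_eq, character_neg]
      rfl
    · intro j _ hj
      rw [Matrix.diagonal_apply_ne _ hj.symm, C_0, zero_mul]
    · simp

lemma act_stdTorus_monomial (t : Fin 2 → ℂˣ) (d : Fin 3 ⊕ Fin 3 →₀ ℕ) (c : ℂ) :
    act (stdTorus t) (monomial d c) = character (monWeight d) t • monomial d c := by
  have h1 : character (monWeight d) t = ∏ s, (Sum.elim (fun i => character (stdWeight i) t)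
      (fun i => (character (stdWeight i) t)⁻¹) s) ^ d s := by
    rw [monWeight, character_sum, Fintype.prod_sum_type, ← Finset.prod_mul_distrib]
    refine Finset.prod_congr rfl fun i _ => ?_
    rw [character_zsmul, zpow_sub₀ (character_ne_zero _ _)]
    simp [div_eq_mul_inv]
  have h2 : ∏ s, act (stdTorus t) (X s ^ d s) =
      (∏ s, C (Sum.elim (fun i => character (stdWeight i) t)
        (fun i => (character (stdWeight i) t)⁻¹) s) ^ d s) * ∏ s, (X s : Poly) ^ d s := by
    rw [← Finset.prod_mul_distrib]
    refine Finset.prod_congr rfl fun s _ => ?_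
    rw [map_pow, act_stdTorus_X, mul_pow]
  rw [h1, monomial_eq, Finsupp.prod_fintype _ _ (by simp), map_mul, act_C, map_prod, h2,
    smul_eq_C_mul, map_prod]
  simp only [C_pow]
  exact mul_left_comm _ _ _

lemma monomial_mem_weightSpace (d : Fin 3 ⊕ Fin 3 →₀ ℕ) (c : ℂ) :
    monomial d c ∈ weightSpace polyRep stdTorus (monWeight d) :=
  fun t => act_stdTorus_monomial t d c

lemma exists_isWeightDecomp_poly (p : Poly) :
    ∃ f, IsWeightDecomp polyRep stdTorus p f ∧
      (f.support : Set (Fin 2 → ℤ)) = monWeight '' p.support := by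
  classical
  have h := isWeightDecomp_sum (ρ := polyRep) (χ := stdTorus) p.support
    (fun d => monomial d (coeff d p)) monWeight fun d _ => monomial_mem_weightSpace d _
  rw [← p.as_sum] at h
  refine ⟨_, h, ?_⟩
  ext a
  constructor
  · intro ha
    obtain ⟨d, hd, rfl⟩ := mem_support_sum_single (Finset.mem_coe.mp ha)
    exact ⟨d, hd, rfl⟩
  · rintro ⟨d, hd, rfl⟩
    rw [Finset.mem_coe, Finsupp.mem_support_iff, Finsupp.finsetSum_apply]
    intro h0
    have h1 := congrArg (coeff d) h0
    rw [coeff_sum, coeff_zero, Finset.sum_eq_single d] at h1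
    · rw [Finsupp.single_eq_same, coeff_monomial, if_pos rfl] at h1
      exact mem_support_iff.mp (Finset.mem_coe.mp hd) h1
    · intro e _ he
      rw [Finsupp.single_apply]
      split_ifs
      · rw [coeff_monomial, if_neg he]
      · exact coeff_zero _
    · exact fun h => absurd hd h

/-- The weights of a vector of `Γ_{a,b}` are the weights of its monomials. -/
lemma exists_isWeightDecomp_gam {a b : ℕ} (x : Gam a b) :
    ∃ f, IsWeightDecomp (gamRep a b) stdTorus x f ∧
      (f.support : Set (Fin 2 → ℤ)) = monWeight '' (x : Poly).support := by
  obtain ⟨f, hf, hs⟩ := exists_isWeightDecomp_poly (x : Poly)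
  obtain ⟨g, hg, hgs⟩ := hf.subrepresentation (Gam a b) (fun A p hp => ((gamRep a b A) ⟨p, hp⟩).2) x
  exact ⟨g, hg, by rw [hgs, hs]⟩

lemma bideg_of_mem_support {a b : ℕ} {p : Poly} (hp : IsWeightedHomogeneous bideg p (a, b))
    {d : Fin 3 ⊕ Fin 3 →₀ ℕ} (hd : d ∈ p.support) :
    d (Sum.inl 0) + d (Sum.inl 1) + d (Sum.inl 2) = a ∧
      d (Sum.inr 0) + d (Sum.inr 1) + d (Sum.inr 2) = b := by
  have h := hp (mem_support_iff.mp hd)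
  rw [Finsupp.weight_apply, Finsupp.sum_fintype _ _ (by simp), Fintype.sum_sum_type,
    Fin.sum_univ_three, Fin.sum_univ_three] at h
  simpa [bideg] using h

lemma monWeight_mem_of_mem_weightSpace {p : Poly} {a : Fin 2 → ℤ}
    (hp : p ∈ weightSpace polyRep stdTorus a) {d : Fin 3 ⊕ Fin 3 →₀ ℕ} (hd : d ∈ p.support) :
    monWeight d = a := by
  have h1 : IsWeightDecomp polyRep stdTorus p (Finsupp.single a p) := by
    have := isWeightDecomp_sum (ρ := polyRep) (χ := stdTorus) {()} (fun _ => p) (fun _ => a)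
      fun _ _ => hp
    simpa using this
  obtain ⟨f, hf, hs⟩ := exists_isWeightDecomp_poly p
  have h2 : monWeight d ∈ (f.support : Set (Fin 2 → ℤ)) := hs ▸ ⟨d, hd, rfl⟩
  rw [hf.unique h1] at h2
  exact Finset.mem_singleton.mp (Finsupp.support_single_subset h2)

lemma repM3_stdTorus_single (t : Fin 2 → ℂˣ) (i j : Fin 3) (c : ℂ) :
    repM3 (stdTorus t) (Pi.single i (Pi.single j c)) =
      character (stdWeight j) t • (Pi.single i (Pi.single j c) : Fin 3 → Fin 3 → ℂ) := by
  funext l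
  change (stdTorus t).1.mulVec ((Pi.single i (Pi.single j c) : Fin 3 → Fin 3 → ℂ) l) = _
  rw [stdTorus_apply]
  by_cases hl : l = i
  · subst hl
    rw [Pi.smul_apply, Pi.single_eq_same, Matrix.mulVec_single]
    funext m
    by_cases hm : m = j
    · subst hm
      simp [mul_comm]
    · simp [hm]
  · rw [Pi.smul_apply, Pi.single_eq_of_ne hl, Matrix.mulVec_zero, smul_zero]

lemma exists_isWeightDecomp_repM3 (x : Fin 3 → Fin 3 → ℂ) :
    ∃ f, IsWeightDecomp repM3 stdTorus x f ∧ ∀ a ∈ f.support, ∃ j, stdWeight j = a := by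
  have h := isWeightDecomp_sum (ρ := repM3) (χ := stdTorus) (Finset.univ ×ˢ Finset.univ)
    (fun p : Fin 3 × Fin 3 => Pi.single p.1 (Pi.single p.2 (x p.1 p.2))) (fun p => stdWeight p.2)
    fun p _ t => repM3_stdTorus_single t _ _ _
  have hx : ∑ p ∈ (Finset.univ : Finset (Fin 3)) ×ˢ (Finset.univ : Finset (Fin 3)),
      (Pi.single p.1 (Pi.single p.2 (x p.1 p.2)) : Fin 3 → Fin 3 → ℂ) = x := by
    rw [Finset.sum_product]
    conv_rhs => rw [← Finset.univ_sum_single x]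
    refine Finset.sum_congr rfl fun i _ => ?_
    conv_rhs => rw [← Finset.univ_sum_single (x i)]
    exact (map_sum (AddMonoidHom.single (fun _ : Fin 3 => Fin 3 → ℂ) i) _ _).symm
  rw [hx] at h
  refine ⟨_, h, fun a ha => ?_⟩
  obtain ⟨p, -, rfl⟩ := mem_support_sum_single ha
  exact ⟨p.2, rfl⟩

lemma repDegree_gam_le (k : ℕ) : repDegree (gamRep 0 (k + 1)) ≤ 2 * (k + 1) := by
  refine Nat.sInf_le ⟨by omega, ?_⟩
  refine convexHull_min ?_ ((convex_convexHull ℝ _).smul _)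
  rintro _ ⟨a, ha, rfl⟩
  obtain ⟨x, hx, hx0⟩ := (Submodule.ne_bot_iff _).mp ha
  have hx0' : (x : Poly) ≠ 0 := fun h => hx0 (Subtype.ext h)
  obtain ⟨d, hd⟩ := support_nonempty.mpr hx0'
  have hx' : (x : Poly) ∈ weightSpace polyRep stdTorus a := fun t => congrArg Subtype.val (hx t)
  have hda := monWeight_mem_of_mem_weightSpace hx' hd
  obtain ⟨hd1, hd2⟩ := bideg_of_mem_support x.2.1 hd
  have hL : ∀ j, toReal (stdWeight j) ∈ repPolytope repM3 stdTorus := by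
    intro j
    refine subset_convexHull ℝ _ ⟨_, ?_, rfl⟩
    refine (Submodule.ne_bot_iff _).mpr ⟨Pi.single 0 (Pi.single j 1),
      fun t => repM3_stdTorus_single t _ _ _, fun h => ?_⟩
    have := congrFun (congrFun h 0) j
    simp at this
  have hd1' : (d (Sum.inl 0) = 0 ∧ d (Sum.inl 1) = 0) ∧ d (Sum.inl 2) = 0 := by omega
  have hd2' : (d (Sum.inr 0) + d (Sum.inr 1) + d (Sum.inr 2) : ℝ) = k + 1 := by exact_mod_cast hd2
  have hk : (0 : ℝ) < 2 * (k + 1) := by positivity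
  have h0 : (0 : ℝ) ≤ d (Sum.inr 0) := by positivity
  have h1 : (0 : ℝ) ≤ d (Sum.inr 1) := by positivity
  have h2 : (0 : ℝ) ≤ d (Sum.inr 2) := by positivity
  refine ⟨∑ j, ((k + 1 - d (Sum.inr j)) / (2 * (k + 1)) : ℝ) • toReal (stdWeight j),
    (convex_convexHull ℝ _).sum_mem (fun j _ => ?_) ?_ fun j _ => hL j, ?_⟩
  · refine div_nonneg ?_ hk.le
    fin_cases j <;> simp <;> linarith
  · rw [Fin.sum_univ_three]
    field_simp
    linarith
  · rw [← hda]
    funext l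
    simp only [Fin.sum_univ_three, monWeight, hd1']
    push_cast
    fin_cases l <;> simp [toReal, stdWeight] <;> field_simp <;> ring

end StandardWeights

section Criterion

/-- The value on the weight of a monomial of the functional with the values `μ i` on the weights
of the `e_i`. -/
def monValue (μ : Fin 3 → ℝ) (d : Fin 3 ⊕ Fin 3 →₀ ℕ) : ℝ :=
  ∑ i, ((d (Sum.inl i) : ℝ) - d (Sum.inr i)) * μ i

lemma exists_sorted (μ : Fin 3 → ℝ) :
    ∃ i j l : Fin 3, i ≠ j ∧ j ≠ l ∧ i ≠ l ∧ μ j ≤ μ i ∧ μ l ≤ μ j := by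
  rcases le_total (μ 0) (μ 1) with h1 | h1 <;> rcases le_total (μ 1) (μ 2) with h2 | h2 <;>
    rcases le_total (μ 0) (μ 2) with h3 | h3
  · exact ⟨2, 1, 0, by decide, by decide, by decide, h2, h1⟩
  · exact ⟨2, 1, 0, by decide, by decide, by decide, h2, h1⟩
  · exact ⟨1, 2, 0, by decide, by decide, by decide, h2, h3⟩
  · exact ⟨1, 0, 2, by decide, by decide, by decide, h1, h3⟩
  · exact ⟨2, 0, 1, by decide, by decide, by decide, h3, h1⟩
  · exact ⟨0, 2, 1, by decide, by decide, by decide, h3, h2⟩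
  · exact ⟨0, 1, 2, by decide, by decide, by decide, h1, h2⟩
  · exact ⟨0, 1, 2, by decide, by decide, by decide, h1, h2⟩

lemma eq_or_of_ne_of_ne : ∀ {i j l : Fin 3}, i ≠ j → j ≠ l → i ≠ l → ∀ m, m = i ∨ m = j ∨ m = l := by
  decide

@[to_additive]
lemma prod_fin_three_of_ne {M : Type*} [CommMonoid M] {i j l : Fin 3} (hij : i ≠ j) (hjl : j ≠ l)
    (hil : i ≠ l) (f : Fin 3 → M) : ∏ m, f m = f i * f j * f l := by
  have h : (Finset.univ : Finset (Fin 3)) = {i, j, l} := by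
    symm
    rw [Finset.eq_univ_iff_forall]
    revert i j l
    decide
  rw [h, Finset.prod_insert (by simp [hij, hil]), Finset.prod_insert (by simp [hjl]),
    Finset.prod_singleton, mul_assoc]

/-- Either the monomial `e_i^{2k-c} e_j^c ⊗ e_l^*` with `c < k` occurs in `y`, or `e_l^*` occurs in
the monomials of `x` with exponent at most `k - 1` and one of the monomials
`e_i^{2k-1-c} e_j^c e_l ⊗ e_l^*` with `c ≤ 1` occurs in `y`. -/
def DominatingMonomial (k : ℕ) (x y : Poly) (i j l : Fin 3) : Prop :=
  (∃ d ∈ y.support, ∃ c < k, d (Sum.inl i) + c = 2 * k ∧ d (Sum.inl j) = c ∧ d (Sum.inl l) = 0 ∧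
    d (Sum.inr i) = 0 ∧ d (Sum.inr j) = 0 ∧ d (Sum.inr l) = 1) ∨
  ((∀ e ∈ x.support, e (Sum.inr l) + 1 ≤ k) ∧
    ∃ d ∈ y.support, ∃ c ≤ 1, d (Sum.inl i) + c + 1 = 2 * k ∧ d (Sum.inl j) = c ∧
      d (Sum.inl l) = 1 ∧ d (Sum.inr i) = 0 ∧ d (Sum.inr j) = 0 ∧ d (Sum.inr l) = 1)

lemma exists_dominating {k : ℕ} (hk : 4 ≤ k) {x y : Poly}
    (hx : IsWeightedHomogeneous bideg x (0, k + 1))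
    (h : ∀ i j l : Fin 3, i ≠ j → j ≠ l → i ≠ l → DominatingMonomial k x y i j l)
    (μ : Fin 3 → ℝ) (hμ : ∑ i, μ i = 0) :
    ∃ d ∈ y.support, ∃ M B : ℝ, 0 ≤ M ∧ (∀ j, μ j ≤ M) ∧ (∀ e ∈ x.support, monValue μ e ≤ B) ∧
      B ≤ monValue μ d ∧ 2 * (k + 1) * M + (k + 1) * B ≤ (k + 2) * monValue μ d := by
  obtain ⟨i, j, l, hij, hjl, hil, h1, h2⟩ := exists_sorted μ
  have hμ' : μ l = -μ i - μ j := by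
    rw [sum_fin_three_of_ne hij hjl hil] at hμ
    linarith
  have hM : ∀ m, μ m ≤ μ i := by
    intro m
    obtain rfl | rfl | rfl : m = i ∨ m = j ∨ m = l := by
      exact eq_or_of_ne_of_ne hij hjl hil m
    · exact le_rfl
    · exact h1
    · exact h2.trans h1
  have hM0 : 0 ≤ μ i := by linarith
  have hk' : (4 : ℝ) ≤ k := by exact_mod_cast hk
  have hS : ∀ d, monValue μ d = ((d (Sum.inl i) : ℝ) - d (Sum.inr i)) * μ i +
      ((d (Sum.inl j) : ℝ) - d (Sum.inr j)) * μ j + ((d (Sum.inl l) : ℝ) - d (Sum.inr l)) * μ l :=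
    fun d => sum_fin_three_of_ne hij hjl hil _
  have hxe : ∀ e ∈ x.support, monValue μ e = -(e (Sum.inr i) * μ i) - e (Sum.inr j) * μ j -
      e (Sum.inr l) * μ l ∧ (e (Sum.inr i) + e (Sum.inr j) + e (Sum.inr l) : ℝ) = k + 1 := by
    intro e he
    obtain ⟨ha, hb⟩ := bideg_of_mem_support hx he
    have ha' : ∀ m, e (Sum.inl m) = 0 := fun m => by fin_cases m <;> simp <;> omega
    rw [hS, ha', ha', ha']
    refine ⟨by push_cast; ring, ?_⟩
    have h3 := sum_fin_three_of_ne hij hjl hil fun m => e (Sum.inr m)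
    rw [Fin.sum_univ_three, hb] at h3
    exact_mod_cast h3.symm
  rcases h i j l hij hjl hil with ⟨d, hd, c, hc, e1, e2, e3, e4, e5, e6⟩ |
    ⟨hx', d, hd, c, hc, e1, e2, e3, e4, e5, e6⟩
  · have e1' : (d (Sum.inl i) : ℝ) = 2 * k - c := by
      rw [eq_sub_iff_add_eq]
      exact_mod_cast e1
    have hc' : (c : ℝ) + 1 ≤ k := by exact_mod_cast hc
    have hd' : monValue μ d = (2 * k - c) * μ i + c * μ j - μ l := by
      rw [hS, e1', e2, e3, e4, e5, e6]
      push_cast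
      ring
    have hd'' : -(k + 1) * μ l + (μ i - μ j) ≤ monValue μ d := by
      rw [hd', hμ']
      nlinarith [mul_nonneg (sub_nonneg.mpr hc') (sub_nonneg.mpr h1)]
    refine ⟨d, hd, μ i, -(k + 1) * μ l, hM0, hM, fun e he => ?_, by linarith, ?_⟩
    · obtain ⟨he1, he2⟩ := hxe e he
      rw [he1, ← he2]
      have q1 : (0 : ℝ) ≤ e (Sum.inr i) * (μ i - μ l) :=
        mul_nonneg (Nat.cast_nonneg _) (by linarith)
      have q2 : (0 : ℝ) ≤ e (Sum.inr j) * (μ j - μ l) :=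
        mul_nonneg (Nat.cast_nonneg _) (by linarith)
      linarith
    · have q := mul_le_mul_of_nonneg_left hd'' (by positivity : (0 : ℝ) ≤ k + 2)
      refine le_trans ?_ q
      rw [hμ']
      nlinarith
  · have e1' : (d (Sum.inl i) : ℝ) = 2 * k - 1 - c := by
      rw [eq_sub_iff_add_eq, eq_sub_iff_add_eq]
      exact_mod_cast e1
    have hc' : (c : ℝ) ≤ 1 := by exact_mod_cast hc
    have hd' : monValue μ d = (2 * k - 1 - c) * μ i + c * μ j := by
      rw [hS, e1', e2, e3, e4, e5, e6]
      push_cast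
      ring
    have hd'' : (2 * k - 2) * μ i + μ j ≤ monValue μ d := by
      rw [hd']
      nlinarith [mul_nonneg (sub_nonneg.mpr hc') (sub_nonneg.mpr h1)]
    have hB : 3 * μ i ≤ (2 * k - 2) * μ i + μ j - (-2 * μ j - (k - 1) * μ l) := by
      rw [hμ']
      nlinarith [mul_nonneg (sub_nonneg.mpr hk') (sub_nonneg.mpr h1)]
    refine ⟨d, hd, μ i, -2 * μ j - (k - 1) * μ l, hM0, hM, fun e he => ?_, by linarith, ?_⟩
    · obtain ⟨he1, he2⟩ := hxe e he
      have he3 : (e (Sum.inr l) : ℝ) + 1 ≤ k := by exact_mod_cast hx' e he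
      rw [he1]
      have q1 : (0 : ℝ) ≤ e (Sum.inr i) * (μ i - μ j) :=
        mul_nonneg (Nat.cast_nonneg _) (by linarith)
      have q2 : (0 : ℝ) ≤ (k - 1 - e (Sum.inr l)) * (μ j - μ l) :=
        mul_nonneg (by linarith) (by linarith)
      have q3 : (e (Sum.inr j) : ℝ) = k + 1 - e (Sum.inr i) - e (Sum.inr l) := by linarith
      rw [q3]
      linarith
    · have q := mul_le_mul_of_nonneg_left hd'' (by positivity : (0 : ℝ) ≤ k + 2)
      refine le_trans ?_ q
      rw [hμ']
      nlinarith [mul_nonneg (sub_nonneg.mpr hk') hM0, mul_nonneg (sub_nonneg.mpr hk') (sub_nonneg.mpr h1)]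

lemma linear_monWeight {r : ℕ} {N : (Fin 2 → ℤ) → Fin r → ℤ} (hN : ∀ a b, N (a + b) = N a + N b)
    (L : (Fin r → ℝ) →ₗ[ℝ] ℝ) (d : Fin 3 ⊕ Fin 3 →₀ ℕ) :
    L (toReal (N (monWeight d))) = monValue (fun i => L (toReal (N (stdWeight i)))) d := by
  let Φ : (Fin 2 → ℤ) →+ ℝ := AddMonoidHom.mk' (fun a => L (toReal (N a))) fun a b => by
    rw [hN, ← map_add]
    congr 1
    funext l
    simp [toReal]
  change Φ (monWeight d) = ∑ i, _ * Φ (stdWeight i)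
  rw [monWeight, map_sum]
  refine Finset.sum_congr rfl fun i _ => ?_
  rw [map_zsmul, zsmul_eq_mul]
  push_cast
  rfl

lemma sum_linear_stdWeight {r : ℕ} {N : (Fin 2 → ℤ) → Fin r → ℤ}
    (hN : ∀ a b, N (a + b) = N a + N b) (L : (Fin r → ℝ) →ₗ[ℝ] ℝ) :
    ∑ i, L (toReal (N (stdWeight i))) = 0 := by
  have h := linear_monWeight hN L (∑ i, Finsupp.single (Sum.inl i) 1)
  have h2 : monWeight (∑ i, Finsupp.single (Sum.inl i) 1) = 0 := by
    funext l
    fin_cases l <;> simp [monWeight, Fin.sum_univ_three, stdWeight]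
  have h3 : N 0 = 0 := by simpa using hN 0 0
  rw [h2, h3] at h
  rw [show toReal (0 : Fin r → ℤ) = 0 by funext; simp [toReal], map_zero] at h
  rw [h]
  simp [monValue, Fin.sum_univ_three]

lemma toReal_sum {r : ℕ} {ι : Type*} (s : Finset ι) (f : ι → Fin r → ℤ) :
    toReal (∑ i ∈ s, f i) = ∑ i ∈ s, toReal (f i) := by
  funext l
  simp [toReal]

lemma numStable_of_dominating {k : ℕ} (hk : 4 ≤ k) (x : Gam 0 (k + 1)) (y : Gam (2 * k) 1)
    (h : ∀ (A : SL3) (i j l : Fin 3), i ≠ j → j ≠ l → i ≠ l →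
      DominatingMonomial k (act A x) (act A y) i j l) :
    IsNumSemistable (gamRep 0 (k + 1)) (gamRep (2 * k) 1) x y ∧
      IsNumStable (gamRep 0 (k + 1)) (gamRep (2 * k) 1) x y := by
  have key : ∀ (r : ℕ) (χ : (Fin r → ℂˣ) →* SL3), IsTorusParam χ → Maximal IsTorus χ.range →
      ∃ f g h, IsWeightDecomp (gamRep 0 (k + 1)) χ x f ∧ IsWeightDecomp (gamRep (2 * k) 1) χ y g ∧
        IsWeightDecomp repM3 χ vecI h ∧ ∀ L : (Fin r → ℝ) →ₗ[ℝ] ℝ, ∃ a ∈ g.support, ∃ M B : ℝ,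
          0 ≤ M ∧ (∀ b ∈ h.support, L (toReal b) ≤ M) ∧ (∀ b ∈ f.support, L (toReal b) ≤ B) ∧
          B ≤ L (toReal a) ∧ 2 * (k + 1) * M + (k + 1) * B ≤ (k + 2) * L (toReal a) := by
    intro r χ hχ hmax
    obtain ⟨A, ψ, N, hA, hN, hinj, hadd⟩ := exists_conj_stdTorus hχ hmax
    obtain ⟨f₀, hf₀, hf₀'⟩ := exists_isWeightDecomp_gam (gamRep 0 (k + 1) A⁻¹ x)
    obtain ⟨f, hf, hf'⟩ := hf₀.conj hA hN hinj
    obtain ⟨g₀, hg₀, hg₀'⟩ := exists_isWeightDecomp_gam (gamRep (2 * k) 1 A⁻¹ y)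
    obtain ⟨g, hg, hg'⟩ := hg₀.conj hA hN hinj
    obtain ⟨h₀, hh₀, hh₀'⟩ := exists_isWeightDecomp_repM3 (repM3 A⁻¹ vecI)
    obtain ⟨h', hh, hh'⟩ := hh₀.conj hA hN hinj
    refine ⟨f, g, h', hf, hg, hh, fun L => ?_⟩
    obtain ⟨d, hd, M, B, hM0, hM, hB, hBd, hfin⟩ := exists_dominating hk
      (act_homogeneous A⁻¹ x.2.1) (h A⁻¹) _ (sum_linear_stdWeight hadd L)
    rw [← linear_monWeight hadd] at hBd hfin
    refine ⟨N (monWeight d), ?_, M, B, hM0, fun b hb => ?_, fun b hb => ?_, hBd, hfin⟩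
    · rw [← Finset.mem_coe, hg', hg₀']
      exact ⟨_, ⟨d, hd, rfl⟩, rfl⟩
    · rw [← Finset.mem_coe, hh'] at hb
      obtain ⟨a, ha, rfl⟩ := hb
      obtain ⟨j, rfl⟩ := hh₀' a ha
      exact hM j
    · rw [← Finset.mem_coe, hf', hf₀'] at hb
      obtain ⟨_, ⟨e, he, rfl⟩, rfl⟩ := hb
      rw [linear_monWeight hadd]
      exact hB e he
  refine ⟨fun r χ hχ hmax => ?_, k + 1, by omega, fun r χ hχ hmax => ?_⟩
  · obtain ⟨f, g, _, hf, hg, -, hL⟩ := key r χ hχ hmax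
    refine weightPolytope_subset (by rw [hg.weights_eq]; exact Finset.finite_toSet _) fun L => ?_
    obtain ⟨a, ha, M, B, -, -, hB, hBa, -⟩ := hL L
    rw [hg.weights_eq, hf.weights_eq]
    exact ⟨a, ha, fun b hb => (hB b hb).trans hBa⟩
  · obtain ⟨f, g, h, hf, hg, hh, hL⟩ := key r χ hχ hmax
    obtain ⟨g', hg', -, hgm⟩ := hg.vecPow (k + 1 + 1)
    obtain ⟨f', hf', hfm, -⟩ := hf.vecPow (k + 1)
    obtain ⟨h', hh', hhm, -⟩ := hh.vecPow (repDegree (gamRep 0 (k + 1)))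
    obtain ⟨u, hu, hum⟩ := hh'.tmul hf'
    refine weightPolytope_subset (by rw [hg'.weights_eq]; exact Finset.finite_toSet _) fun L => ?_
    obtain ⟨a, ha, M, B, hM0, hM, hB, hBa, hfin⟩ := hL L
    rw [hg'.weights_eq, hu.weights_eq]
    refine ⟨_, hgm a ha, fun b hb => ?_⟩
    obtain ⟨b₁, hb₁, b₂, hb₂, rfl⟩ := hum b hb
    obtain ⟨s₁, hs₁, rfl⟩ := hhm b₁ hb₁
    obtain ⟨s₂, hs₂, rfl⟩ := hfm b₂ hb₂
    have e1 : L (toReal ((k + 1 + 1) • a)) = (k + 2) * L (toReal a) := by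
      have : toReal ((k + 1 + 1) • a) = ((k : ℝ) + 2) • toReal a := by
        funext l
        simp only [toReal, Pi.smul_apply, nsmul_eq_mul, smul_eq_mul]
        push_cast
        ring
      rw [this, map_smul, smul_eq_mul]
    have e2 : L (toReal (∑ i, s₁ i + ∑ i, s₂ i)) =
        ∑ i, L (toReal (s₁ i)) + ∑ i, L (toReal (s₂ i)) := by
      rw [← map_sum, ← map_sum, ← map_add, ← toReal_sum, ← toReal_sum]
      congr 1
      funext l
      simp [toReal]
    have e3 : ∑ i, L (toReal (s₁ i)) ≤ 2 * (k + 1) * M := by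
      refine (Finset.sum_le_card_nsmul _ _ M fun i _ => hM _ (hs₁ i)).trans ?_
      rw [Finset.card_univ, Fintype.card_fin, nsmul_eq_mul]
      refine mul_le_mul_of_nonneg_right ?_ hM0
      exact_mod_cast repDegree_gam_le k
    have e4 : ∑ i, L (toReal (s₂ i)) ≤ (k + 1) * B := by
      refine (Finset.sum_le_card_nsmul _ _ B fun i _ => hB _ (hs₂ i)).trans ?_
      simp
    rw [e1, e2]
    linarith

end Criterion

section Generic

variable {E : Type} [AddCommGroup E] [Module ℂ E]

lemma Generically.mono {P Q : E → Prop} (hP : Generically P) (h : ∀ x, P x → Q x) :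
    Generically Q := by
  obtain ⟨F, hF, hP⟩ := hP
  exact ⟨F, hF, fun x hx => h x (hP x hx)⟩

lemma generically_of_forall {P : E → Prop} (h : ∀ x, P x) : Generically P :=
  ⟨1, ⟨0, by simp⟩, fun x _ => h x⟩

/-- The restriction of a polynomial function to a line is polynomial. -/
lemma exists_polynomial_line (F : MvPolynomial (Module.Dual ℂ E) ℂ) (x y : E) :
    ∃ f : Polynomial ℂ, ∀ t : ℂ,
      f.eval t = eval (fun φ : Module.Dual ℂ E => φ (x + t • y)) F := by
  refine ⟨aeval (fun φ : Module.Dual ℂ E => Polynomial.C (φ x) + Polynomial.C (φ y) * Polynomial.X)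
    F, fun t => ?_⟩
  induction F using MvPolynomial.induction_on with
  | C c => rw [← algebraMap_eq, AlgHom.commutes, algebraMap_eq, eval_C]; exact Polynomial.eval_C
  | add p q hp hq => simp only [map_add, Polynomial.eval_add, hp, hq]
  | mul_X p φ hp =>
    rw [map_mul, map_mul, Polynomial.eval_mul, hp, aeval_X, eval_X, Polynomial.eval_add,
      Polynomial.eval_mul, Polynomial.eval_C, Polynomial.eval_C, Polynomial.eval_X, map_add,
      map_smul, smul_eq_mul, mul_comm t]

lemma Generically.and {P Q : E → Prop} (hP : Generically P) (hQ : Generically Q) :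
    Generically fun x => P x ∧ Q x := by
  obtain ⟨F, ⟨x, hx⟩, hF⟩ := hP
  obtain ⟨G, ⟨y, hy⟩, hG⟩ := hQ
  refine ⟨F * G, ?_, fun z hz => ?_⟩
  · obtain ⟨f, hf⟩ := exists_polynomial_line F x (y - x)
    obtain ⟨g, hg⟩ := exists_polynomial_line G x (y - x)
    have hf0 : f ≠ 0 := by
      rintro rfl
      have := hf 0
      simp only [zero_smul, add_zero, Polynomial.eval_zero] at this
      exact hx this.symm
    have hg0 : g ≠ 0 := by
      rintro rfl
      have := hg 1
      simp only [one_smul, add_sub_cancel, Polynomial.eval_zero] at this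
      exact hy this.symm
    obtain ⟨t, ht⟩ := Polynomial.exists_eval_ne_zero_of_natDegree_lt_card (f * g)
      (mul_ne_zero hf0 hg0) (Cardinal.natCast_lt_aleph0.trans_le (Cardinal.aleph0_le_mk ℂ))
    refine ⟨x + t • (y - x), ?_⟩
    rw [map_mul, ← hf, ← hg, ← Polynomial.eval_mul]
    exact ht
  · rw [map_mul] at hz
    exact ⟨hF z (left_ne_zero_of_mul hz), hG z (right_ne_zero_of_mul hz)⟩

lemma generically_finset {ι : Type*} (s : Finset ι) {P : ι → E → Prop}
    (h : ∀ i ∈ s, Generically (P i)) : Generically fun x => ∀ i ∈ s, P i x := by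
  classical
  induction s using Finset.induction_on with
  | empty => exact generically_of_forall fun x => by simp
  | insert i s _ ih =>
    refine ((h i (Finset.mem_insert_self i s)).and
      (ih fun j hj => h j (Finset.mem_insert_of_mem hj))).mono fun x hx j hj => ?_
    rcases Finset.mem_insert.mp hj with rfl | hj
    · exact hx.1
    · exact hx.2 j hj

lemma generically_dual_ne_zero (φ : Module.Dual ℂ E) {x : E} (hx : φ x ≠ 0) :
    Generically fun y => φ y ≠ 0 :=
  ⟨X φ, ⟨x, by simpa using hx⟩, fun y hy => by simpa using hy⟩

lemma exists_basis_sum [FiniteDimensional ℂ E] {κ : Type} {s : κ → E}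
    (hs : LinearIndependent ℂ s) :
    ∃ (ι : Type) (_ : Fintype ι) (b : Module.Basis (κ ⊕ ι) ℂ E), ∀ c, b (Sum.inl c) = s c := by
  let b := Module.Basis.sumExtend hs
  have hfin := Module.Finite.finite_basis b
  have hfin' : Finite (Module.Basis.sumExtendIndex hs) :=
    Finite.of_injective (Sum.inr : _ → κ ⊕ Module.Basis.sumExtendIndex hs) Sum.inr_injective
  refine ⟨_, Fintype.ofFinite _, b, fun c => ?_⟩
  simp only [b, Module.Basis.sumExtend, Module.Basis.reindex_apply, Module.Basis.extend_apply_self]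
  rfl

/-- Consider `n` affine linear equations on a vector space, with coefficients that are polynomials
in fewer than `n - 1` parameters. A generic vector violates one of them for all values of the
parameters for which the equations are independent on the span of `s`. -/
lemma generically_of_det_ne_zero [FiniteDimensional ℂ E] {σ : Type} [Fintype σ] {n : ℕ}
    (hn : Fintype.card σ + 1 < n) (β : Fin n → E →ₗ[ℂ] MvPolynomial σ ℂ)
    (β₀ : Fin n → MvPolynomial σ ℂ) (s : Fin n → E) :
    Generically fun x : E => ∀ p : σ → ℂ,
      (Matrix.of fun c c' => eval p (β c (s c'))).det ≠ 0 →
        ∃ c, eval p (β c x + β₀ c) ≠ 0 := by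
  classical
  by_cases hp : ∀ p : σ → ℂ, (Matrix.of fun c c' => eval p (β c (s c'))).det = 0
  · exact generically_of_forall fun x p h => absurd (hp p) h
  push Not at hp
  obtain ⟨p₀, hp₀⟩ := hp
  have hs : LinearIndependent ℂ s := by
    rw [Fintype.linearIndependent_iff]
    intro a ha
    refine congrFun (Matrix.eq_zero_of_mulVec_eq_zero hp₀ (v := a) ?_)
    funext c
    have h1 := congrArg (fun x => eval p₀ (β c x)) ha
    simpa [Matrix.mulVec, dotProduct, mul_comm] using h1
  obtain ⟨ι, _, b, hb⟩ := exists_basis_sum hs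
  let θ : MvPolynomial σ ℂ →ₐ[ℂ] MvPolynomial (Option σ ⊕ ι) ℂ := rename (Sum.inl ∘ some)
  let M : Matrix (Fin n) (Fin n) (MvPolynomial σ ℂ) := Matrix.of fun c c' => β c (s c')
  let u : Fin n → MvPolynomial (Option σ ⊕ ι) ℂ := fun c =>
    θ (β₀ c) + ∑ i, X (Sum.inr i) * θ (β c (b (Sum.inr i)))
  let Q : Fin n → MvPolynomial (Option σ ⊕ ι) ℂ :=
    -(X (Sum.inl none) : MvPolynomial (Option σ ⊕ ι) ℂ) • (M.map θ).adjugate.mulVec u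
  have hdep : ¬ AlgebraicIndependent ℂ (Sum.elim Q fun i => X (Sum.inr i)) := by
    intro h
    have h1 := h.lift_cardinalMk_le_trdeg
    rw [MvPolynomial.trdeg_of_isDomain] at h1
    simp only [Cardinal.mk_fintype, Fintype.card_sum, Fintype.card_option, Fintype.card_fin,
      Cardinal.lift_natCast, Nat.cast_le] at h1
    omega
  rw [algebraicIndependent_iff] at hdep
  push Not at hdep
  obtain ⟨F, hF, hF0⟩ := hdep
  have heval : ∀ x, eval (fun φ : Module.Dual ℂ E => φ x) (rename b.coord F) =
      eval (fun j => b.repr x j) F := fun x => by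
    rw [eval_rename]
    rfl
  refine ⟨rename b.coord F, ?_, fun x hx p hpd => ?_⟩
  · obtain ⟨z, hz⟩ : ∃ z, eval z F ≠ 0 := by
      by_contra! h
      exact hF0 (MvPolynomial.funext fun z => by rw [h z, map_zero])
    refine ⟨b.equivFun.symm z, ?_⟩
    have h1 : (fun j => b.repr (b.equivFun.symm z) j) = z := by
      funext j
      rw [← Module.Basis.equivFun_apply, LinearEquiv.apply_symm_apply]
    rwa [heval, h1]
  · by_contra! hc
    apply hx
    rw [heval]
    let D := (Matrix.of fun c c' => eval p (β c (s c'))).det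
    let P : Option σ ⊕ ι → ℂ := Sum.elim (fun o => o.elim D⁻¹ p) fun i => b.repr x (Sum.inr i)
    have hθ : ∀ f, eval P (θ f) = eval p f := fun f => by
      rw [eval_rename]
      rfl
    have hu : (fun c => eval P (u c)) =
        -(Matrix.of fun c c' => eval p (β c (s c'))).mulVec fun c => b.repr x (Sum.inl c) := by
      funext c
      have h1 := hc c
      have h2 : x = ∑ c, b.repr x (Sum.inl c) • s c + ∑ i, b.repr x (Sum.inr i) • b (Sum.inr i) := by
        conv_lhs => rw [← b.sum_repr x, Fintype.sum_sum_type]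
        simp only [hb]
      rw [h2] at h1
      simp only [map_add, map_sum, map_smul, smul_eval] at h1
      simp only [u, map_add, map_sum, map_mul, hθ, eval_X, Pi.neg_apply, Matrix.mulVec, dotProduct,
        Matrix.of_apply]
      have h3 : ∀ i, P (Sum.inr i) = b.repr x (Sum.inr i) := fun i => rfl
      simp only [h3]
      rw [← add_eq_zero_iff_eq_neg, ← h1]
      simp only [mul_comm]
      ring
    have hP : (fun j => b.repr x j) = fun j => eval P (Sum.elim Q (fun i => X (Sum.inr i)) j) := by
      funext j
      rcases j with c | i
      · have h4 : (fun c => eval P ((M.map θ).adjugate.mulVec u c)) =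
            ((Matrix.of fun c c' => eval p (β c (s c'))).adjugate).mulVec
              fun c => eval P (u c) := by
          funext c
          rw [RingHom.map_mulVec, ← RingHom.mapMatrix_apply, RingHom.map_adjugate]
          congr 2
          ext i j
          simp [M, hθ]
        have h5 := congrFun h4 c
        rw [hu, Matrix.mulVec_neg, Matrix.mulVec_mulVec, Matrix.adjugate_mul, Matrix.smul_mulVec,
          Matrix.one_mulVec, Pi.neg_apply, Pi.smul_apply, smul_eq_mul] at h5
        simp only [Sum.elim_inl, Q, Pi.smul_apply, smul_eq_mul, map_mul, map_neg, eval_X, h5]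
        change _ = -D⁻¹ * -(D * _)
        have hD : D ≠ 0 := hpd
        field_simp
      · simp [P]
    rw [hP]
    have h6 := congrArg (eval P) hF
    rw [map_zero, aeval_def, ← coe_eval₂Hom, ← RingHom.comp_apply] at h6
    rw [← h6]
    refine RingHom.congr_fun (MvPolynomial.ringHom_ext (fun c => ?_) fun j => ?_) F
    · simp
    · simp

end Generic

section Flags

/-- Substitution of the points of the line through `q` and `r`, and of the covector `n`. -/
def flagEval (q r n : Fin 3 → ℂ) : Poly →ₐ[ℂ] Polynomial ℂ :=
  aeval (Sum.elim (fun m => Polynomial.C (q m) + Polynomial.C (r m) * Polynomial.X)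
    fun m => Polynomial.C (n m))

@[simp]
lemma flagEval_eVec (q r n : Fin 3 → ℂ) (m : Fin 3) : flagEval q r n (eVec m) =
    Polynomial.C (q m) + Polynomial.C (r m) * Polynomial.X := by
  simp [flagEval, eVec]

@[simp]
lemma flagEval_eDual (q r n : Fin 3 → ℂ) (m : Fin 3) :
    flagEval q r n (eDual m) = Polynomial.C (n m) := by
  simp [flagEval, eDual]

@[simp]
lemma flagEval_C (q r n : Fin 3 → ℂ) (c : ℂ) : flagEval q r n (C c) = Polynomial.C c := by
  simp [flagEval]

/-- The restriction of the `e_l^*`-component to the line spanned by `e_i` and `e_j`. -/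
def coordEval (i j l : Fin 3) : Poly →ₐ[ℂ] Polynomial ℂ :=
  aeval (Sum.elim (fun m => if m = i then 1 else if m = j then Polynomial.X else 0)
    fun m => if m = l then 1 else 0)

lemma coordEval_act (A : SL3) {i j l : Fin 3} (hij : i ≠ j) (hjl : j ≠ l) (hil : i ≠ l) (p : Poly) :
    coordEval i j l (act A p) = flagEval (A.1 i) (A.1 j) (fun m => (A⁻¹).1 m l) p := by
  refine DFunLike.congr_fun (MvPolynomial.algHom_ext (f := (coordEval i j l).comp (act A))
    (g := flagEval (A.1 i) (A.1 j) (fun m => (A⁻¹).1 m l)) ?_) p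
  rintro (m | m)
  · change coordEval i j l (act A (eVec m)) = flagEval _ _ _ (eVec m)
    rw [act_eVec, flagEval_eVec, sum_fin_three_of_ne hij hjl hil]
    simp [coordEval, eVec, hij.symm, hjl.symm, hil.symm]
  · change coordEval i j l (act A (eDual m)) = flagEval _ _ _ (eDual m)
    rw [act_eDual, flagEval_eDual, sum_fin_three_of_ne hij hjl hil]
    simp [coordEval, eDual, hjl, hil]

lemma exists_mem_support_of_coordEval {i j l : Fin 3} (hij : i ≠ j) (hjl : j ≠ l) (hil : i ≠ l)
    {p : Poly} {c : ℕ} (h : (coordEval i j l p).coeff c ≠ 0) :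
    ∃ d ∈ p.support, d (Sum.inl j) = c ∧ d (Sum.inl l) = 0 ∧ d (Sum.inr i) = 0 ∧
      d (Sum.inr j) = 0 := by
  rw [p.as_sum, map_sum, Polynomial.finsetSum_coeff] at h
  obtain ⟨d, hd, hdc⟩ := Finset.exists_ne_zero_of_sum_ne_zero h
  refine ⟨d, hd, ?_⟩
  rw [monomial_eq, Finsupp.prod_fintype _ _ (by simp), map_mul, map_prod, Fintype.prod_sum_type,
    prod_fin_three_of_ne hij hjl hil, prod_fin_three_of_ne hij hjl hil] at hdc
  simp only [coordEval, map_pow, aeval_X, Sum.elim_inl, Sum.elim_inr, if_neg hij.symm,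
    if_neg hjl.symm, if_neg hil.symm, if_neg hjl, if_neg hil, one_pow, one_mul, mul_one,
    if_true] at hdc
  have h1 : d (Sum.inl l) = 0 := by
    by_contra h0
    simp [zero_pow h0] at hdc
  have h2 : d (Sum.inr i) = 0 := by
    by_contra h0
    simp [zero_pow h0] at hdc
  have h3 : d (Sum.inr j) = 0 := by
    by_contra h0
    simp [zero_pow h0] at hdc
  refine ⟨?_, h1, h2, h3⟩
  rw [h1, h2, h3] at hdc
  simp only [pow_zero, mul_one, aeval_C] at hdc
  by_contra h0
  rw [Polynomial.algebraMap_eq, Polynomial.coeff_C_mul, Polynomial.coeff_X_pow,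
    if_neg fun h => h0 h.symm, mul_zero] at hdc
  exact hdc rfl

lemma bideg_sum_of_ne {a b : ℕ} {p : Poly} (hp : IsWeightedHomogeneous bideg p (a, b))
    {d : Fin 3 ⊕ Fin 3 →₀ ℕ} (hd : d ∈ p.support) {i j l : Fin 3} (hij : i ≠ j) (hjl : j ≠ l)
    (hil : i ≠ l) : d (Sum.inl i) + d (Sum.inl j) + d (Sum.inl l) = a ∧
      d (Sum.inr i) + d (Sum.inr j) + d (Sum.inr l) = b := by
  have h := bideg_of_mem_support hp hd
  rwa [← Fin.sum_univ_three fun m => d (Sum.inl m), ← Fin.sum_univ_three fun m => d (Sum.inr m),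
    sum_fin_three_of_ne hij hjl hil, sum_fin_three_of_ne hij hjl hil] at h

lemma exists_monomial_of_flagEval (A : SL3) {i j l : Fin 3} (hij : i ≠ j) (hjl : j ≠ l)
    (hil : i ≠ l) {a c : ℕ} {p : Poly} (hp : IsWeightedHomogeneous bideg p (a, 1))
    (h : (flagEval (A.1 i) (A.1 j) (fun m => (A⁻¹).1 m l) p).coeff c ≠ 0) :
    ∃ d ∈ (act A p).support, d (Sum.inl i) + c = a ∧ d (Sum.inl j) = c ∧ d (Sum.inl l) = 0 ∧
      d (Sum.inr i) = 0 ∧ d (Sum.inr j) = 0 ∧ d (Sum.inr l) = 1 := by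
  rw [← coordEval_act A hij hjl hil] at h
  obtain ⟨d, hd, h1, h2, h3, h4⟩ := exists_mem_support_of_coordEval hij hjl hil h
  obtain ⟨h5, h6⟩ := bideg_sum_of_ne (act_homogeneous A hp) hd hij hjl hil
  exact ⟨d, hd, by omega, h1, h2, h3, h4, by omega⟩

lemma exists_monomial_of_flagEval_pderiv (A : SL3) {i j l : Fin 3} (hij : i ≠ j) (hjl : j ≠ l)
    (hil : i ≠ l) {a c : ℕ} {p : Poly} (hp : IsWeightedHomogeneous bideg p (a, 1))
    (h : (∑ m, Polynomial.C (A.1 l m) * flagEval (A.1 i) (A.1 j) (fun m => (A⁻¹).1 m l)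
      (pderiv (Sum.inl m) p)).coeff c ≠ 0) :
    ∃ d ∈ (act A p).support, d (Sum.inl i) + c + 1 = a ∧ d (Sum.inl j) = c ∧ d (Sum.inl l) = 1 ∧
      d (Sum.inr i) = 0 ∧ d (Sum.inr j) = 0 ∧ d (Sum.inr l) = 1 := by
  have h0 : coordEval i j l (pderiv (Sum.inl l) (act A p)) = ∑ m, Polynomial.C (A.1 l m) *
      flagEval (A.1 i) (A.1 j) (fun m => (A⁻¹).1 m l) (pderiv (Sum.inl m) p) := by
    rw [pderiv_inl_act, map_sum]
    refine Finset.sum_congr rfl fun m _ => ?_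
    rw [map_mul, coordEval_act A hij hjl hil, ← algebraMap_eq, AlgHom.commutes,
      Polynomial.algebraMap_eq]
  rw [← h0] at h
  obtain ⟨d, hd, h1, h2, h3, h4⟩ := exists_mem_support_of_coordEval hij hjl hil h
  have hd' : d + Finsupp.single (Sum.inl l) 1 ∈ (act A p).support := by
    rw [mem_support_iff] at hd ⊢
    rw [coeff_pderiv] at hd
    exact left_ne_zero_of_mul hd
  obtain ⟨h5, h6⟩ := bideg_sum_of_ne (act_homogeneous A hp) hd' hij hjl hil
  refine ⟨_, hd', ?_⟩
  simp [hjl, hil] at h5 h6 ⊢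
  omega

lemma exists_cross (A : SL3) {i j l : Fin 3} (hij : i ≠ j) (hjl : j ≠ l) (hil : i ≠ l) :
    ∃ ε : ℂ, ε ≠ 0 ∧ (fun m => (A⁻¹).1 m l) = ε • crossProduct (A.1 i) (A.1 j) := by
  have h : ∀ m, (A⁻¹).1 m l = A.1.adjugate m l := fun m => by
    rw [Matrix.SpecialLinearGroup.coe_inv]
  simp only [h, Matrix.adjugate_fin_three, cross_apply]
  fin_cases i <;> fin_cases j <;> fin_cases l <;>
    first
    | exact absurd rfl hij
    | exact absurd rfl hjl
    | exact absurd rfl hil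
    | (refine ⟨1, one_ne_zero, ?_⟩
       funext m
       fin_cases m <;> simp <;> ring1)
    | (refine ⟨-1, neg_ne_zero.mpr one_ne_zero, ?_⟩
       funext m
       fin_cases m <;> simp <;> ring1)

end Flags

section LowWeights

instance finiteDimensional_gam (a b : ℕ) : FiniteDimensional ℂ (Gam a b) := by
  have h : Gam a b ≤ homogeneousSubmodule (Fin 3 ⊕ Fin 3) ℂ (a + b) := by
    intro p hp d hd
    obtain ⟨h1, h2⟩ := bideg_of_mem_support hp.1 (mem_support_iff.mpr hd)
    rw [Finsupp.weight_apply, Finsupp.sum_fintype _ _ (by simp), Fintype.sum_sum_type,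
      Fin.sum_univ_three, Fin.sum_univ_three]
    simp
    omega
  have hfg : (homogeneousSubmodule (Fin 3 ⊕ Fin 3) ℂ (a + b)).FG :=
    weightedHomogeneousSubmodule_fg ℂ 1 (by simp) _
  have := Module.Finite.iff_fg.mpr hfg
  exact Submodule.finiteDimensional_of_le h

lemma l3_monWeight (d : Fin 3 ⊕ Fin 3 →₀ ℕ) : l3 (monWeight d) =
    d (Sum.inl 0) + d (Sum.inl 1) + d (Sum.inl 2) -
      (d (Sum.inr 0) + d (Sum.inr 1) + d (Sum.inr 2)) -
        3 * ((d (Sum.inl 2) : ℤ) - d (Sum.inr 2)) := by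
  simp [l3, monWeight, Fin.sum_univ_three, stdWeight]
  ring

lemma Wprime_support {k : ℕ} (x : Wprime k) {d : Fin 3 ⊕ Fin 3 →₀ ℕ}
    (hd : d ∈ (x : Poly).support) : d (Sum.inr 2) + 2 ≤ d (Sum.inl 2) := by
  have h : Wprime k ≤ (restrictSupport ℂ {d : Fin 3 ⊕ Fin 3 →₀ ℕ |
      d (Sum.inr 2) + 2 ≤ d (Sum.inl 2)}).comap (Gam (2 * k) 1).subtype := by
    refine iSup₂_le fun a ha y hy => ?_
    rw [Submodule.mem_comap, mem_restrictSupport_iff]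
    intro d hd
    have hy' : (y : Poly) ∈ weightSpace polyRep stdTorus a := fun t => congrArg Subtype.val (hy t)
    have h1 := monWeight_mem_of_mem_weightSpace hy' hd
    obtain ⟨h2, h3⟩ := bideg_of_mem_support y.2.1 hd
    rw [← h1, l3_monWeight] at ha
    change d (Sum.inr 2) + 2 ≤ d (Sum.inl 2)
    omega
  have h1 := h x.2
  rw [Submodule.mem_comap, mem_restrictSupport_iff] at h1
  exact h1 hd

lemma monomial_mem_gam {a b : ℕ} {d : Fin 3 ⊕ Fin 3 →₀ ℕ}
    (ha : d (Sum.inl 0) + d (Sum.inl 1) + d (Sum.inl 2) = a)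
    (hb : d (Sum.inr 0) + d (Sum.inr 1) + d (Sum.inr 2) = b)
    (hd : ∀ i, d (Sum.inl i) = 0 ∨ d (Sum.inr i) = 0) : monomial d 1 ∈ Gam a b := by
  constructor
  · refine isWeightedHomogeneous_monomial _ _ _ ?_
    rw [Finsupp.weight_apply, Finsupp.sum_fintype _ _ (by simp), Fintype.sum_sum_type,
      Fin.sum_univ_three, Fin.sum_univ_three]
    simp [bideg, ha, hb]
  · change contraction _ = 0
    rw [contraction_apply]
    refine Finset.sum_eq_zero fun i _ => ?_
    rw [pderiv_monomial, pderiv_monomial]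
    rcases hd i with h | h <;> simp [h]

lemma exists_mem_Wprime {k : ℕ} {d : Fin 3 ⊕ Fin 3 →₀ ℕ}
    (ha : d (Sum.inl 0) + d (Sum.inl 1) + d (Sum.inl 2) = 2 * k)
    (hb : d (Sum.inr 0) + d (Sum.inr 1) + d (Sum.inr 2) = 1)
    (hd : ∀ i, d (Sum.inl i) = 0 ∨ d (Sum.inr i) = 0) (h2 : d (Sum.inr 2) + 2 ≤ d (Sum.inl 2)) :
    ∃ x : Wprime k, (x : Poly) = monomial d 1 := by
  refine ⟨⟨⟨monomial d 1, monomial_mem_gam ha hb hd⟩, ?_⟩, rfl⟩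
  refine Submodule.mem_iSup_of_mem (monWeight d) (Submodule.mem_iSup_of_mem ?_ ?_)
  · rw [l3_monWeight]
    omega
  · exact fun t => Subtype.ext (monomial_mem_weightSpace d 1 t)

/-- The vectors `e_i^{a} e_3^{2k-a} ⊗ e_j^*` of `W'`. -/
lemma exists_eq_mem_Wprime {k a b : ℕ} (hab : a + b = 2 * k) (hb : 2 ≤ b) {i j : Fin 3}
    (hij : i ≠ j) (hi : i ≠ 2) (hj : j ≠ 2) :
    ∃ x : Wprime k, (x : Poly) = eVec i ^ a * eVec 2 ^ b * eDual j := by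
  have h : eVec i ^ a * eVec 2 ^ b * eDual j = monomial (Finsupp.single (Sum.inl i) a +
      Finsupp.single (Sum.inl 2) b + Finsupp.single (Sum.inr j) 1) (1 : ℂ) := by
    rw [eVec, eVec, eDual, X_pow_eq_monomial, X_pow_eq_monomial, X, monomial_mul, monomial_mul]
    simp
  rw [h]
  refine exists_mem_Wprime ?_ ?_ (fun m => ?_) ?_
  · fin_cases i <;> simp at hi ⊢ <;> exact hab
  · fin_cases j <;> simp at hj ⊢
  · by_cases hm : m = j
    · subst hm
      left
      simp [hij, hj.symm]
    · right
      simp [Ne.symm hm]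
  · simp [hi, hj, hb]

lemma coeff_flagEval_monomial {q r n : Fin 3 → ℂ} (hq : q 2 = 0) {d : Fin 3 ⊕ Fin 3 →₀ ℕ}
    (hd : d (Sum.inr 2) + 2 ≤ d (Sum.inl 2)) (a : ℂ) {c : ℕ} (hc : c ≤ 2) :
    (flagEval q r n (monomial d a)).coeff c = if c = 2 ∧ d (Sum.inl 2) = 2 then
      a * r 2 ^ 2 * (q 0 ^ d (Sum.inl 0) * q 1 ^ d (Sum.inl 1) *
        (n 0 ^ d (Sum.inr 0) * n 1 ^ d (Sum.inr 1))) else 0 := by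
  have h1 : flagEval q r n (monomial d a) = Polynomial.X ^ d (Sum.inl 2) *
      (Polynomial.C (a * r 2 ^ d (Sum.inl 2)) *
        ((Polynomial.C (q 0) + Polynomial.C (r 0) * Polynomial.X) ^ d (Sum.inl 0) *
        (Polynomial.C (q 1) + Polynomial.C (r 1) * Polynomial.X) ^ d (Sum.inl 1) *
        Polynomial.C (n 0 ^ d (Sum.inr 0) * n 1 ^ d (Sum.inr 1) * n 2 ^ d (Sum.inr 2)))) := by
    rw [monomial_eq, Finsupp.prod_fintype _ _ (by simp), map_mul, map_prod, flagEval_C,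
      Fintype.prod_sum_type, Fin.prod_univ_three, Fin.prod_univ_three]
    simp only [map_pow]
    change _ * (flagEval q r n (eVec 0) ^ _ * flagEval q r n (eVec 1) ^ _ *
      flagEval q r n (eVec 2) ^ _ * (flagEval q r n (eDual 0) ^ _ * flagEval q r n (eDual 1) ^ _ *
      flagEval q r n (eDual 2) ^ _)) = _
    simp only [flagEval_eVec, flagEval_eDual, hq, map_mul, map_pow, Polynomial.C_0, zero_add]
    ring
  rw [h1]
  split_ifs with h
  · have h2 : d (Sum.inr 2) = 0 := by omega
    rw [h.1, h.2, h2]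
    have := Polynomial.coeff_X_pow_mul (Polynomial.C (a * r 2 ^ 2) *
        ((Polynomial.C (q 0) + Polynomial.C (r 0) * Polynomial.X) ^ d (Sum.inl 0) *
        (Polynomial.C (q 1) + Polynomial.C (r 1) * Polynomial.X) ^ d (Sum.inl 1) *
        Polynomial.C (n 0 ^ d (Sum.inr 0) * n 1 ^ d (Sum.inr 1) * n 2 ^ 0))) 2 0
    rw [zero_add] at this
    rw [this, Polynomial.coeff_zero_eq_eval_zero]
    simp
  · exact Polynomial.coeff_X_pow_mul' _ _ _ |>.trans (if_neg (by omega))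

lemma coeff_flagEval_Wprime_of_lt {k : ℕ} (x : Wprime k) {q r n : Fin 3 → ℂ} (hq : q 2 = 0) {c : ℕ}
    (hc : c < 2) : (flagEval q r n (x : Poly)).coeff c = 0 := by
  rw [(x : Poly).as_sum, map_sum, Polynomial.finsetSum_coeff]
  refine Finset.sum_eq_zero fun d hd => ?_
  rw [coeff_flagEval_monomial hq (Wprime_support x hd) _ hc.le, if_neg (by omega)]

lemma coeff_two_flagEval_Wprime {k : ℕ} (x : Wprime k) {q r n q' n' : Fin 3 → ℂ} {a b : ℂ}
    (hq : q 2 = 0) (hq' : q' 2 = 0) (h0 : q 0 = a * q' 0) (h1 : q 1 = a * q' 1)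
    (hn0 : n 0 = b * n' 0) (hn1 : n 1 = b * n' 1) :
    (flagEval q r n (x : Poly)).coeff 2 = r 2 ^ 2 * a ^ (2 * k - 2) * b *
      (flagEval q' ![0, 0, 1] n' (x : Poly)).coeff 2 := by
  rw [(x : Poly).as_sum, map_sum, map_sum, Polynomial.finsetSum_coeff, Polynomial.finsetSum_coeff,
    Finset.mul_sum]
  refine Finset.sum_congr rfl fun d hd => ?_
  rw [coeff_flagEval_monomial hq (Wprime_support x hd) _ le_rfl,
    coeff_flagEval_monomial hq' (Wprime_support x hd) _ le_rfl]
  have hd2 := Wprime_support x hd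
  obtain ⟨h2, h3⟩ := bideg_of_mem_support x.1.2.1 hd
  split_ifs with h
  · have h4 : 2 * k - 2 = d (Sum.inl 0) + d (Sum.inl 1) := by omega
    have h5 : b = b ^ (d (Sum.inr 0) + d (Sum.inr 1)) := by
      rw [show d (Sum.inr 0) + d (Sum.inr 1) = 1 by omega, pow_one]
    rw [h0, h1, hn0, hn1, h4]
    conv_rhs => rw [h5]
    simp only [mul_pow, pow_add, Matrix.cons_val, one_pow, mul_one]
    ring
  · rw [mul_zero]

lemma flagEval_smul {a : ℕ} {p : Poly} (hp : IsWeightedHomogeneous bideg p (a, 1))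
    (q r n : Fin 3 → ℂ) (ε : ℂ) :
    flagEval q r (ε • n) p = Polynomial.C ε * flagEval q r n p := by
  rw [p.as_sum, map_sum, map_sum, Finset.mul_sum]
  refine Finset.sum_congr rfl fun d hd => ?_
  obtain ⟨-, h⟩ := bideg_of_mem_support hp hd
  rw [flagEval, flagEval, monomial_eq, Finsupp.prod_fintype _ _ (by simp), map_mul, map_mul,
    map_prod, map_prod, Fintype.prod_sum_type, Fintype.prod_sum_type]
  simp only [map_pow, aeval_X, Sum.elim_inl, Sum.elim_inr, Pi.smul_apply, smul_eq_mul, map_mul,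
    mul_pow, Finset.prod_mul_distrib, Finset.prod_pow_eq_pow_sum, Fin.sum_univ_three, h, pow_one]
  simp only [aeval_C]
  ring

end LowWeights

section Tangency

lemma det_coeff_linear_pow_ne_zero {a₀ a₁ b₀ b₁ e : ℂ} (hb : b₀ ≠ 0) (hab : a₀ * b₁ - a₁ * b₀ ≠ 0)
    (he : e ≠ 0) {n N : ℕ} (hn : n ≤ N + 1) :
    (Matrix.of fun c c' : Fin n => (Polynomial.C e *
      ((Polynomial.C a₀ + Polynomial.C a₁ * Polynomial.X) ^ (c' : ℕ) *
        (Polynomial.C b₀ + Polynomial.C b₁ * Polynomial.X) ^ (N - c'))).coeff c).det ≠ 0 := by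
  rw [Ne, ← Matrix.exists_mulVec_eq_zero_iff]
  rintro ⟨v, hv, h⟩
  apply hv
  set P : Polynomial ℂ := Polynomial.C a₀ + Polynomial.C a₁ * Polynomial.X with hP
  set Q : Polynomial ℂ := Polynomial.C b₀ + Polynomial.C b₁ * Polynomial.X with hQ
  have hPd : P.natDegree ≤ 1 := by rw [hP, add_comm]; exact Polynomial.natDegree_linear_le
  have hQd : Q.natDegree ≤ 1 := by rw [hQ, add_comm]; exact Polynomial.natDegree_linear_le
  let R : Polynomial ℂ := ∑ c : Fin n, Polynomial.C (v c) * (P ^ (c : ℕ) * Q ^ (n - 1 - c))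
  have hR : Polynomial.X ^ n ∣ R * Q ^ (N + 1 - n) := by
    rw [Polynomial.X_pow_dvd_iff]
    intro d hd
    have h1 := congrFun h ⟨d, hd⟩
    rw [Matrix.mulVec, dotProduct, Pi.zero_apply] at h1
    rw [Finset.sum_mul, Polynomial.finsetSum_coeff]
    refine (mul_eq_zero.mp (?_ : e * _ = 0)).resolve_left he
    rw [Finset.mul_sum, ← h1]
    refine Finset.sum_congr rfl fun c _ => ?_
    have h2 : Q ^ (N - c) = Q ^ (n - 1 - c) * Q ^ (N + 1 - n) := by
      rw [← pow_add]
      congr 1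
      omega
    rw [Matrix.of_apply, Polynomial.coeff_C_mul, h2, mul_assoc, Polynomial.coeff_C_mul, mul_assoc]
    ring
  have hcop : IsCoprime (Polynomial.X ^ n) (Q ^ (N + 1 - n)) := by
    refine IsCoprime.pow ⟨-Polynomial.C (b₁ * b₀⁻¹), Polynomial.C b₀⁻¹, ?_⟩
    have h3 : Polynomial.C b₀⁻¹ * Polynomial.C b₀ = (1 : Polynomial ℂ) := by
      rw [← Polynomial.C_mul, inv_mul_cancel₀ hb, Polynomial.C_1]
    rw [hQ, Polynomial.C_mul]
    linear_combination h3
  have hR0 : R = 0 := by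
    by_contra hR0
    have h4 := Polynomial.natDegree_le_of_dvd (hcop.dvd_of_dvd_mul_right hR) hR0
    rw [Polynomial.natDegree_X_pow] at h4
    have hn0 : n ≠ 0 := by
      rintro rfl
      exact hv (funext fun c => c.elim0)
    have h5 : R.natDegree ≤ n - 1 := by
      refine Polynomial.natDegree_sum_le_of_forall_le _ _ fun c _ => ?_
      refine (Polynomial.natDegree_C_mul_le _ _).trans (Polynomial.natDegree_mul_le.trans ?_)
      have h6 := Polynomial.natDegree_pow_le_of_le (c : ℕ) hPd
      have h7 := Polynomial.natDegree_pow_le_of_le (n - 1 - c) hQd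
      have := c.2
      omega
    omega
  let A : Polynomial ℂ := ∑ c : Fin n, Polynomial.C (v c) * Polynomial.X ^ (c : ℕ)
  have hA : ∀ y, a₁ - y * b₁ ≠ 0 → A.IsRoot y := by
    intro y hy
    let x := -(a₀ - y * b₀) / (a₁ - y * b₁)
    have hx : P.eval x = y * Q.eval x := by
      simp only [hP, hQ, Polynomial.eval_add, Polynomial.eval_mul, Polynomial.eval_C,
        Polynomial.eval_X, x]
      field_simp
      ring
    have hQx : Q.eval x ≠ 0 := by
      intro h0
      rw [h0, mul_zero] at hx
      simp only [hP, hQ, Polynomial.eval_add, Polynomial.eval_mul, Polynomial.eval_C,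
        Polynomial.eval_X] at h0 hx
      have h8 : x * (a₀ * b₁ - a₁ * b₀) = 0 := by linear_combination a₀ * h0 - b₀ * hx
      have h9 : x = 0 := (mul_eq_zero.mp h8).resolve_right hab
      rw [h9] at h0
      exact hb (by simpa using h0)
    have h10 : R.eval x = Q.eval x ^ (n - 1) * A.eval y := by
      rw [Polynomial.eval_finsetSum, Polynomial.eval_finsetSum, Finset.mul_sum]
      refine Finset.sum_congr rfl fun c _ => ?_
      rw [Polynomial.eval_mul, Polynomial.eval_mul, Polynomial.eval_mul, Polynomial.eval_pow,
        Polynomial.eval_pow, Polynomial.eval_pow, Polynomial.eval_C, Polynomial.eval_C,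
        Polynomial.eval_X, hx, mul_pow]
      have h11 : Q.eval x ^ (n - 1) = Q.eval x ^ (c : ℕ) * Q.eval x ^ (n - 1 - c) := by
        rw [← pow_add]
        congr 1
        have := c.2
        omega
      rw [h11]
      ring
    rw [hR0, Polynomial.eval_zero] at h10
    exact (mul_eq_zero.mp h10.symm).resolve_left (pow_ne_zero _ hQx)
  have hfin : {y : ℂ | a₁ - y * b₁ = 0}.Subsingleton := by
    intro y hy y' hy'
    have hy : a₁ - y * b₁ = 0 := hy
    have hy' : a₁ - y' * b₁ = 0 := hy'
    have hb1 : b₁ ≠ 0 := by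
      rintro rfl
      rw [mul_zero, sub_zero] at hy
      exact hab (by rw [hy]; ring)
    exact mul_right_cancel₀ hb1 (by linear_combination hy' - hy)
  have hA0 : A = 0 := Polynomial.eq_zero_of_infinite_isRoot A
    (hfin.finite.infinite_compl.mono fun y hy => hA y hy)
  funext c
  have h12 := congrArg (fun p : Polynomial ℂ => p.coeff c) hA0
  simp only [A, Polynomial.finsetSum_coeff, Polynomial.coeff_C_mul, Polynomial.coeff_X_pow,
    Polynomial.coeff_zero] at h12
  rw [Finset.sum_eq_single c] at h12
  · simpa using h12
  · intro b _ hb'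
    rw [if_neg fun h => hb' (Fin.ext h.symm), mul_zero]
  · simp

/-- The substitution `flagEval` for indeterminate points. -/
def genericFlagEval : Poly →ₐ[ℂ] Polynomial (MvPolynomial (Fin 3 ⊕ Fin 3) ℂ) :=
  aeval (Sum.elim
    (fun m => Polynomial.C (X (Sum.inl m)) + Polynomial.C (X (Sum.inr m)) * Polynomial.X)
    fun m => Polynomial.C (crossProduct (fun m => X (Sum.inl m)) (fun m => X (Sum.inr m)) m))

lemma map_genericFlagEval (q r : Fin 3 → ℂ) (p : Poly) :
    (genericFlagEval p).map (eval (Sum.elim q r)) = flagEval q r (crossProduct q r) p := by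
  have h : (Polynomial.mapRingHom (eval (Sum.elim q r))).comp genericFlagEval.toRingHom =
      (flagEval q r (crossProduct q r)).toRingHom := by
    apply MvPolynomial.ringHom_ext
    · intro c
      simp [genericFlagEval, flagEval]
    · rintro (m | m)
      · simp [genericFlagEval, flagEval]
      · fin_cases m <;> simp [genericFlagEval, flagEval, cross_apply]
  exact RingHom.congr_fun h p

lemma generically_flagEval {k : ℕ} (hk : 5 ≤ k) {i j : Fin 3} (hij : i ≠ j) (hi : i ≠ 2)
    (hj : j ≠ 2) :
    Generically fun x : Wprime k => ∀ q r : Fin 3 → ℂ, q 2 ≠ 0 → crossProduct q r j ≠ 0 →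
      ∃ c < 8, (flagEval q r (crossProduct q r) (w0Poly k + (x : Poly))).coeff c ≠ 0 := by
  have hs : ∀ c : Fin 8, ∃ x : Wprime k,
      (x : Poly) = eVec i ^ (c : ℕ) * eVec 2 ^ (2 * k - c) * eDual j := fun c =>
    exists_eq_mem_Wprime (by omega) (by omega) hij hi hj
  choose s hs using hs
  let β : Fin 8 → Wprime k →ₗ[ℂ] MvPolynomial (Fin 3 ⊕ Fin 3) ℂ := fun c =>
    (Polynomial.lcoeff (MvPolynomial (Fin 3 ⊕ Fin 3) ℂ) c).restrictScalars ℂ ∘ₗ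
      genericFlagEval.toLinearMap ∘ₗ (Gam (2 * k) 1).subtype ∘ₗ (Wprime k).subtype
  have hβ : ∀ q r c x, eval (Sum.elim q r) (β c x) =
      (flagEval q r (crossProduct q r) (x : Poly)).coeff c := fun q r c x => by
    rw [← map_genericFlagEval, Polynomial.coeff_map]
    rfl
  refine (generically_of_det_ne_zero (by simp) β (fun c => (genericFlagEval (w0Poly k)).coeff c)
    s).mono fun x hx q r hq hn => ?_
  obtain ⟨c, hc⟩ := hx (Sum.elim q r) (by
    have hcr : q i * r 2 - r i * q 2 ≠ 0 := by
      revert hn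
      rw [cross_apply]
      fin_cases i <;> fin_cases j <;> simp at hij hi hj ⊢ <;> contrapose! <;> intro h <;>
        first
        | linear_combination h
        | linear_combination -h
    convert det_coeff_linear_pow_ne_zero hq hcr hn (n := 8) (N := 2 * k) (by omega) using 4 with c
    funext c'
    rw [hβ, hs]
    simp only [map_mul, map_pow, flagEval_eVec, flagEval_eDual]
    rw [mul_comm])
  refine ⟨c, c.2, ?_⟩
  rw [map_add, Polynomial.coeff_add, ← hβ, ← map_genericFlagEval, Polynomial.coeff_map, add_comm,
    ← map_add, add_comm]
  rwa [add_comm] at hc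

end Tangency

section Flags

lemma flagEval_w0Poly {k : ℕ} (hk : 1 ≤ k) {q r n : Fin 3 → ℂ} (hq : ∑ m, n m * q m = 0)
    (hr : ∑ m, n m * r m = 0) :
    flagEval q r n (w0Poly k) = Polynomial.C (-(1 + 1 / (k : ℂ)) * n 0) *
      ((Polynomial.C (q 0) + Polynomial.C (r 0) * Polynomial.X) *
        (Polynomial.C (2 * (k : ℂ)) *
            (Polynomial.C (q 1) + Polynomial.C (r 1) * Polynomial.X) ^ (2 * k - 1) +
          (Polynomial.C (q 0) + Polynomial.C (r 0) * Polynomial.X) ^ (2 * k - 1))) := by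
  have hk' : (k : ℂ) ≠ 0 := by exact_mod_cast (by omega : k ≠ 0)
  have h : (Polynomial.C (q 0) + Polynomial.C (r 0) * Polynomial.X) * Polynomial.C (n 0) +
      (Polynomial.C (q 1) + Polynomial.C (r 1) * Polynomial.X) * Polynomial.C (n 1) +
      (Polynomial.C (q 2) + Polynomial.C (r 2) * Polynomial.X) * Polynomial.C (n 2) = 0 := by
    have hq' := congrArg Polynomial.C hq
    have hr' := congrArg Polynomial.C hr
    simp only [Fin.sum_univ_three, map_add, map_mul, map_zero] at hq' hr'
    linear_combination hq' + Polynomial.X * hr'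
  have h1 : Polynomial.C (1 / (k : ℂ)) * Polynomial.C (k : ℂ) = 1 := by
    rw [← Polynomial.C_mul, one_div_mul_cancel hk', Polynomial.C_1]
  simp only [w0Poly, map_add, map_mul, map_sub, map_pow, flagEval_eVec, flagEval_eDual, flagEval_C,
    Polynomial.C_neg, Polynomial.C_1]
  rw [show (Polynomial.C (2 : ℂ)) = 2 from rfl]
  generalize Polynomial.C (q 0) + Polynomial.C (r 0) * Polynomial.X = x at *
  generalize Polynomial.C (q 1) + Polynomial.C (r 1) * Polynomial.X = y at *
  generalize Polynomial.C (q 2) + Polynomial.C (r 2) * Polynomial.X = z at *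
  linear_combination (x ^ (2 * k - 1) + y ^ (2 * k - 1)) * h +
    2 * Polynomial.C (n 0) * x * y ^ (2 * k - 1) * h1

lemma coeff_one_eq_eval_derivative (p : Polynomial ℂ) : p.coeff 1 = p.derivative.eval 0 := by
  rw [← Polynomial.coeff_zero_eq_eval_zero, Polynomial.coeff_derivative]
  simp

/-- The zeros of `2 k x y^{2k-1} + x^{2k}` are simple. -/
lemma coeff_zero_or_one_of_zero_simple {k : ℕ} (hk : 1 ≤ k) {q r : Fin 3 → ℂ} (hq : q 1 ≠ 0)
    (p : Polynomial ℂ) (hp : p = (Polynomial.C (q 0) + Polynomial.C (r 0) * Polynomial.X) *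
        (Polynomial.C (2 * (k : ℂ)) *
            (Polynomial.C (q 1) + Polynomial.C (r 1) * Polynomial.X) ^ (2 * k - 1) +
          (Polynomial.C (q 0) + Polynomial.C (r 0) * Polynomial.X) ^ (2 * k - 1))) :
    p.coeff 0 ≠ 0 ∨ p.coeff 1 ≠ 0 ∨
      (p = 0 ∧ q 0 * (2 * k * q 1 ^ (2 * k - 1) + q 0 ^ (2 * k - 1)) = 0) := by
  have hk' : (k : ℂ) ≠ 0 := by exact_mod_cast (by omega : k ≠ 0)
  by_cases h0 : p.coeff 0 = 0
  swap
  · exact Or.inl h0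
  right
  have hG : q 0 * (2 * k * q 1 ^ (2 * k - 1) + q 0 ^ (2 * k - 1)) = 0 := by
    rw [Polynomial.coeff_zero_eq_eval_zero, hp] at h0
    simpa using h0
  by_cases hD : q 0 * r 1 - q 1 * r 0 = 0
  · right
    refine ⟨?_, hG⟩
    have hD' : Polynomial.C (q 1) * (Polynomial.C (q 0) + Polynomial.C (r 0) * Polynomial.X) =
        Polynomial.C (q 0) * (Polynomial.C (q 1) + Polynomial.C (r 1) * Polynomial.X) := by
      have := congrArg Polynomial.C hD
      simp only [map_sub, map_mul, map_zero] at this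
      linear_combination -Polynomial.X * this
    have hG' := congrArg Polynomial.C hG
    simp only [map_add, map_mul, map_pow, map_zero] at hG'
    have hpow := congrArg (· ^ (2 * k - 1)) hD'
    simp only [mul_pow] at hpow
    have hmul : Polynomial.C (q 1) * Polynomial.C (q 1) ^ (2 * k - 1) * p = 0 := by
      rw [hp, Polynomial.C_mul]
      generalize Polynomial.C (q 0) + Polynomial.C (r 0) * Polynomial.X = x at *
      generalize Polynomial.C (q 1) + Polynomial.C (r 1) * Polynomial.X = y at *
      linear_combination (Polynomial.C (q 1) ^ (2 * k - 1) * (Polynomial.C 2 * Polynomial.C (k : ℂ) *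
        y ^ (2 * k - 1) + x ^ (2 * k - 1))) * hD' + Polynomial.C (q 0) * y * hpow +
        y * y ^ (2 * k - 1) * hG'
    refine (mul_eq_zero.mp hmul).resolve_left ?_
    rw [← Polynomial.C_pow, ← Polynomial.C_mul]
    exact Polynomial.C_ne_zero.mpr (mul_ne_zero hq (pow_ne_zero _ hq))
  · left
    intro h1
    apply hD
    obtain ⟨M, hM⟩ : ∃ M, 2 * k - 1 = M + 1 := ⟨2 * k - 2, by omega⟩
    have hMk : (M : ℂ) + 2 = 2 * k := by
      have : M + 2 = 2 * k := by omega
      exact_mod_cast this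
    have hM0 : (M : ℂ) + 1 ≠ 0 := by exact_mod_cast Nat.succ_ne_zero M
    rw [hM] at hp hG
    rw [coeff_one_eq_eval_derivative, hp] at h1
    simp [Polynomial.derivative_pow] at h1
    rcases mul_eq_zero.mp hG with hq0 | hq0
    · rw [hq0] at h1 ⊢
      simp only [zero_mul, add_zero, ne_eq, Nat.succ_ne_zero, not_false_eq_true, zero_pow] at h1
      have h2 : r 0 = 0 := by
        have h3 := mul_eq_zero.mp h1
        simpa [hk', hq] using h3
      rw [h2]
      ring
    · have h3 : 2 * k * (M + 1) * q 1 ^ (M + 1) * (q 0 * r 1 - q 1 * r 0) = 0 := by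
        have h4 : q 0 ^ M * q 0 = -(2 * k * (q 1 ^ M * q 1)) := by
          rw [pow_succ, pow_succ] at hq0
          linear_combination hq0
        simp only [pow_succ] at h1 hq0 ⊢
        linear_combination q 1 * h1 - (M + 2) * r 0 * q 1 * h4 + 0 * hMk
      have h5 : (2 * k * (M + 1) * q 1 ^ (M + 1) : ℂ) ≠ 0 :=
        mul_ne_zero (mul_ne_zero (mul_ne_zero two_ne_zero hk') hM0) (pow_ne_zero _ hq)
      exact (mul_eq_zero.mp h3).resolve_left h5

/-- The zeros of `x^{2k-1} + y^{2k-1}` are simple. -/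
lemma coeff_sum_pow_ne_zero {k : ℕ} (hk : 1 ≤ k) {q r : Fin 3 → ℂ}
    (hD : q 0 * r 1 - q 1 * r 0 ≠ 0) : ∃ c ≤ 1,
      ((Polynomial.C (q 1) + Polynomial.C (r 1) * Polynomial.X) ^ (2 * k - 1) +
        (Polynomial.C (q 0) + Polynomial.C (r 0) * Polynomial.X) ^ (2 * k - 1)).coeff c ≠ 0 := by
  obtain ⟨M, hM⟩ : ∃ M, 2 * k - 1 = M + 1 := ⟨2 * k - 2, by omega⟩
  have hM0 : (M : ℂ) + 1 ≠ 0 := by exact_mod_cast Nat.succ_ne_zero M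
  rw [hM]
  by_contra! h
  have h0 := h 0 zero_le_one
  have h1 := h 1 le_rfl
  rw [coeff_one_eq_eval_derivative] at h1
  rw [Polynomial.coeff_zero_eq_eval_zero] at h0
  simp [Polynomial.derivative_pow] at h0 h1
  have h2 : (M + 1) * q 1 ^ M * (q 0 * r 1 - q 1 * r 0) = 0 := by
    rw [pow_succ, pow_succ] at h0
    linear_combination q 0 * h1 - (M + 1) * r 0 * h0
  have hq1 : q 1 ≠ 0 := by
    intro hq1
    rw [hq1, zero_pow (Nat.succ_ne_zero M), zero_add] at h0
    have hq0 := pow_eq_zero_iff (Nat.succ_ne_zero M) |>.mp h0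
    exact hD (by rw [hq0, hq1]; ring)
  exact mul_ne_zero (mul_ne_zero hM0 (pow_ne_zero _ hq1)) hD h2

/-- The conditions on a generic vector of `W'` that are used below. -/
def IsGenericVector (k : ℕ) (x : Wprime k) : Prop :=
  (∀ q r : Fin 3 → ℂ, q 2 ≠ 0 → crossProduct q r 0 ≠ 0 ∨ crossProduct q r 1 ≠ 0 →
    ∃ c < 8, (flagEval q r (crossProduct q r) (w0Poly k + (x : Poly))).coeff c ≠ 0) ∧
  (∀ a : ℂ, a * (2 * k + a ^ (2 * k - 1)) = 0 →
    (flagEval ![a, 1, 0] ![0, 0, 1] ![1, -a, 0] (x : Poly)).coeff 2 ≠ 0) ∧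
  (flagEval ![1, 0, 0] ![0, 0, 1] ![0, 1, 0] (x : Poly)).coeff 2 ≠ 0

lemma generically_isGenericVector {k : ℕ} (hk : 5 ≤ k) : Generically (IsGenericVector k) := by
  have hk' : (k : ℂ) ≠ 0 := by exact_mod_cast (by omega : k ≠ 0)
  let φ : (Fin 3 → ℂ) → (Fin 3 → ℂ) → Module.Dual ℂ (Wprime k) := fun q n =>
    Polynomial.lcoeff ℂ 2 ∘ₗ (flagEval q ![0, 0, 1] n).toLinearMap ∘ₗ
      (Gam (2 * k) 1).subtype ∘ₗ (Wprime k).subtype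
  have hφ : ∀ q n x, φ q n x = (flagEval q ![0, 0, 1] n (x : Poly)).coeff 2 := fun q n x => rfl
  let f : Polynomial ℂ :=
    Polynomial.X * (Polynomial.C (2 * (k : ℂ)) + Polynomial.X ^ (2 * k - 1))
  have hf : f ≠ 0 := by
    refine mul_ne_zero Polynomial.X_ne_zero fun h => ?_
    have h1 := congrArg (Polynomial.eval 0) h
    simp [zero_pow (show 2 * k - 1 ≠ 0 by omega), hk'] at h1
  have h1 : ∀ a : ℂ, Generically fun x : Wprime k =>
      (flagEval ![a, 1, 0] ![0, 0, 1] ![1, -a, 0] (x : Poly)).coeff 2 ≠ 0 := by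
    intro a
    obtain ⟨y, hy⟩ := exists_eq_mem_Wprime (k := k) (a := 2 * k - 2) (b := 2) (by omega) le_rfl
      (i := 1) (j := 0) (by decide) (by decide) (by decide)
    refine generically_dual_ne_zero (φ _ _) (x := y) ?_
    rw [hφ, hy]
    simp
  have h2 : Generically fun x : Wprime k =>
      (flagEval ![1, 0, 0] ![0, 0, 1] ![0, 1, 0] (x : Poly)).coeff 2 ≠ 0 := by
    obtain ⟨y, hy⟩ := exists_eq_mem_Wprime (k := k) (a := 2 * k - 2) (b := 2) (by omega) le_rfl
      (i := 0) (j := 1) (by decide) (by decide) (by decide)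
    refine generically_dual_ne_zero (φ _ _) (x := y) ?_
    rw [hφ, hy]
    simp
  have h3 := generically_flagEval hk (i := 1) (j := 0) (by decide) (by decide) (by decide)
  have h4 := generically_flagEval hk (i := 0) (j := 1) (by decide) (by decide) (by decide)
  refine ((h3.and h4).and ((generically_finset f.roots.toFinset fun a _ => h1 a).and h2)).mono
    fun x hx => ⟨fun q r hq hn => ?_, fun a ha => hx.2.1 a ?_, hx.2.2⟩
  · exact hn.elim (hx.1.1 q r hq) (hx.1.2 q r hq)
  · rw [Multiset.mem_toFinset, Polynomial.mem_roots hf]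
    simpa [f] using ha

/-- A line other than `e_3 = 0` has low order of contact with the vector field. -/
lemma exists_coeff_flagEval_ne_zero {k : ℕ} (hk : 8 ≤ k) {x : Wprime k} (hx : IsGenericVector k x)
    {q r : Fin 3 → ℂ} (hn : crossProduct q r 0 ≠ 0 ∨ crossProduct q r 1 ≠ 0) :
    ∃ c < k, (flagEval q r (crossProduct q r) (w0Poly k + (x : Poly))).coeff c ≠ 0 := by
  have hk' : (k : ℂ) ≠ 0 := by exact_mod_cast (by omega : k ≠ 0)
  by_cases hq2 : q 2 = 0
  swap
  · obtain ⟨c, hc, h⟩ := hx.1 q r hq2 hn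
    exact ⟨c, by omega, h⟩
  have hκ : -(1 + 1 / (k : ℂ)) ≠ 0 := by
    rw [neg_ne_zero]
    have : (1 + 1 / (k : ℂ)) = (k + 1 : ℕ) / k := by
      push_cast
      field_simp
    rw [this]
    exact div_ne_zero (by exact_mod_cast Nat.succ_ne_zero k) hk'
  have hn0 : crossProduct q r 0 = q 1 * r 2 := by simp [cross_apply, hq2]
  have hn1 : crossProduct q r 1 = -q 0 * r 2 := by simp [cross_apply, hq2]
  have hr2 : r 2 ≠ 0 := by
    intro h
    rw [hn0, hn1, h] at hn
    simp at hn
  have hw := flagEval_w0Poly (k := k) (by omega) (q := q) (r := r) (n := crossProduct q r)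
    (by simp [Fin.sum_univ_three, cross_apply]; ring)
    (by simp [Fin.sum_univ_three, cross_apply]; ring)
  by_cases hq1 : q 1 = 0
  · refine ⟨2, by omega, ?_⟩
    have hq0 : q 0 ≠ 0 := by
      intro h
      rw [hn0, hn1, h, hq1] at hn
      simp at hn
    rw [hn0, hq1, zero_mul, mul_zero, Polynomial.C_0, zero_mul] at hw
    rw [map_add, hw, zero_add, coeff_two_flagEval_Wprime x (q' := ![1, 0, 0]) (n' := ![0, 1, 0])
      (a := q 0) (b := -q 0 * r 2) hq2 (by simp) (by simp) (by simp [hq1]) (by simp [hn0, hq1])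
      (by simp [hn1])]
    exact mul_ne_zero (mul_ne_zero (mul_ne_zero (pow_ne_zero _ hr2) (pow_ne_zero _ hq0))
      (mul_ne_zero (neg_ne_zero.mpr hq0) hr2)) hx.2.2
  · have hn0' : crossProduct q r 0 ≠ 0 := by
      rw [hn0]
      exact mul_ne_zero hq1 hr2
    have hsmall : ∀ c < 2, (flagEval q r (crossProduct q r) (w0Poly k + (x : Poly))).coeff c =
        (-(1 + 1 / (k : ℂ)) * crossProduct q r 0) *
          ((Polynomial.C (q 0) + Polynomial.C (r 0) * Polynomial.X) *
        (Polynomial.C (2 * (k : ℂ)) *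
            (Polynomial.C (q 1) + Polynomial.C (r 1) * Polynomial.X) ^ (2 * k - 1) +
          (Polynomial.C (q 0) + Polynomial.C (r 0) * Polynomial.X) ^ (2 * k - 1))).coeff c := by
      intro c hc
      rw [map_add, Polynomial.coeff_add, coeff_flagEval_Wprime_of_lt x hq2 hc, add_zero, hw,
        Polynomial.coeff_C_mul]
    rcases coeff_zero_or_one_of_zero_simple (k := k) (by omega) (r := r) hq1 _ rfl with h | h | ⟨h, h'⟩
    · exact ⟨0, by omega, by rw [hsmall 0 (by omega)]; exact mul_ne_zero (mul_ne_zero hκ hn0') h⟩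
    · exact ⟨1, by omega, by rw [hsmall 1 (by omega)]; exact mul_ne_zero (mul_ne_zero hκ hn0') h⟩
    · refine ⟨2, by omega, ?_⟩
      rw [h, mul_zero] at hw
      have hζ : (q 0 / q 1) * (2 * k + (q 0 / q 1) ^ (2 * k - 1)) = 0 := by
        rw [div_pow]
        have := pow_ne_zero (2 * k - 1) hq1
        field_simp
        rw [mul_comm (2 * (k : ℂ)), mul_comm (q 1 ^ _)]
        linear_combination h'
      rw [map_add, hw, zero_add, coeff_two_flagEval_Wprime x (q' := ![q 0 / q 1, 1, 0])
        (n' := ![1, -(q 0 / q 1), 0]) (a := q 1) (b := q 1 * r 2) hq2 (by simp)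
        (by simp [mul_div_cancel₀, hq1]) (by simp) (by simp [hn0])
        (by rw [hn1]; simp; field_simp)]
      exact mul_ne_zero (mul_ne_zero (mul_ne_zero (pow_ne_zero _ hr2) (pow_ne_zero _ hq1))
        (mul_ne_zero hq1 hr2)) (hx.2.1 _ hζ)

end Flags

section Domination

lemma row_mul_inv (A : SL3) (i l : Fin 3) :
    ∑ m, (A⁻¹).1 m l * A.1 i m = if i = l then 1 else 0 := by
  have h : (A * A⁻¹).1 i l = (1 : SL3).1 i l := by rw [mul_inv_cancel]
  rw [Matrix.SpecialLinearGroup.coe_mul, Matrix.mul_apply, Matrix.SpecialLinearGroup.coe_one,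
    Matrix.one_apply] at h
  rw [← h]
  exact Finset.sum_congr rfl fun m _ => mul_comm _ _

lemma le_of_mem_support_act_vPoly {k : ℕ} (hk : 1 ≤ k) {A : SL3} {l : Fin 3}
    (h : (A⁻¹).1 1 l = 0) {e : Fin 3 ⊕ Fin 3 →₀ ℕ} (he : e ∈ (act A (vPoly k)).support) :
    e (Sum.inr l) + 1 ≤ k := by
  have h1 : degreeOf (Sum.inr l) (act A (eDual 1)) = 0 := by
    rw [← Nat.le_zero, act_eDual]
    refine (degreeOf_sum_le _ _ _).trans (Finset.sup_le fun i _ => ?_)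
    by_cases hi : i = l
    · rw [hi, h, C_0, zero_mul, degreeOf_zero]
    · refine (degreeOf_C_mul_le _ _ _).trans ?_
      rw [eDual, degreeOf_X, if_neg fun h => hi (Sum.inr_injective h).symm]
  have h2 : degreeOf (Sum.inr l) (act A (eDual 2)) ≤ 1 := by
    rw [act_eDual]
    refine (degreeOf_sum_le _ _ _).trans (Finset.sup_le fun i _ => ?_)
    refine (degreeOf_C_mul_le _ _ _).trans ?_
    rw [eDual, degreeOf_X]
    split_ifs <;> omega
  have h3 := monomial_le_degreeOf (Sum.inr l) he
  rw [vPoly, map_mul, map_pow, map_pow] at h3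
  have h4 := (degreeOf_mul_le (Sum.inr l) (act A (eDual 1) ^ 2) (act A (eDual 2) ^ (k - 1))).trans
    (add_le_add (degreeOf_pow_le _ _ _) (degreeOf_pow_le _ _ _))
  rw [h1] at h4
  have h5 := Nat.mul_le_mul_left (k - 1) h2
  omega

lemma flagEval_pderiv_Wprime {k : ℕ} (x : Wprime k) {q r n : Fin 3 → ℂ} (hq : q 2 = 0)
    (hr : r 2 = 0) (m : Fin 3) : flagEval q r n (pderiv (Sum.inl m) (x : Poly)) = 0 := by
  rw [(x : Poly).as_sum, map_sum, map_sum]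
  refine Finset.sum_eq_zero fun d hd => ?_
  have h := Wprime_support x hd
  rw [pderiv_monomial, monomial_eq, Finsupp.prod_fintype _ _ (by simp), map_mul, map_prod,
    Finset.prod_eq_zero (Finset.mem_univ (Sum.inl 2)), mul_zero]
  rw [map_pow]
  change flagEval q r n (eVec 2) ^ _ = 0
  rw [flagEval_eVec, hq, hr, Polynomial.C_0, zero_mul, zero_add]
  refine zero_pow ?_
  rw [Finsupp.tsub_apply, Finsupp.single_apply]
  split_ifs <;> omega

lemma flagEval_pderiv_w0Poly {k : ℕ} {q r n : Fin 3 → ℂ} (hq : q 2 = 0)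
    (hr : r 2 = 0) (hn0 : n 0 = 0) (hn1 : n 1 = 0) (m : Fin 3) :
    flagEval q r n (pderiv (Sum.inl m) (w0Poly k)) = if m = 2 then Polynomial.C (n 2) *
      ((Polynomial.C (q 1) + Polynomial.C (r 1) * Polynomial.X) ^ (2 * k - 1) +
        (Polynomial.C (q 0) + Polynomial.C (r 0) * Polynomial.X) ^ (2 * k - 1)) else 0 := by
  have h1 : ∀ i j : Fin 3, pderiv (Sum.inl i) (eVec j) = if i = j then 1 else 0 := fun i j => by
    rw [eVec, pderiv_X, Pi.single_apply]
    simp [eq_comm]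
  have h2 : ∀ i j : Fin 3, pderiv (Sum.inl i) (eDual j) = 0 := fun i j => by
    rw [eDual, pderiv_X, Pi.single_apply]
    simp
  simp only [w0Poly, map_add, map_sub, Derivation.leibniz, smul_eq_mul, pderiv_C, h1, h2, mul_zero,
    add_zero, zero_add, map_mul, flagEval_eVec, flagEval_eDual, hq, hr, hn0, hn1, Polynomial.C_0,
    zero_mul, map_pow, sub_zero]
  fin_cases m <;> simp
  ring

lemma dominatingMonomial_act {k : ℕ} (hk : 8 ≤ k) {x : Wprime k} (hx : IsGenericVector k x)
    (A : SL3) {i j l : Fin 3} (hij : i ≠ j) (hjl : j ≠ l) (hil : i ≠ l) :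
    DominatingMonomial k (act A (vPoly k)) (act A (w0Poly k + (x : Poly))) i j l := by
  obtain ⟨ε, hε, hn⟩ := exists_cross A hij hjl hil
  have hw : IsWeightedHomogeneous bideg (w0Poly k + (x : Poly)) (2 * k, 1) :=
    (w0Poly_mem (k := k) (by omega)).1.add x.1.2.1
  by_cases hcr : crossProduct (A.1 i) (A.1 j) 0 ≠ 0 ∨ crossProduct (A.1 i) (A.1 j) 1 ≠ 0
  · left
    obtain ⟨c, hc, h⟩ := exists_coeff_flagEval_ne_zero hk hx hcr
    obtain ⟨d, hd, h1⟩ := exists_monomial_of_flagEval A hij hjl hil hw (c := c) (by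
      rw [hn, flagEval_smul hw, Polynomial.coeff_C_mul]
      exact mul_ne_zero hε h)
    exact ⟨d, hd, c, hc, h1⟩
  · right
    push Not at hcr
    obtain ⟨hc0, hc1⟩ := hcr
    have hn0 : (A⁻¹).1 0 l = 0 := by
      rw [congrFun hn 0, Pi.smul_apply, hc0, smul_zero]
    have hn1 : (A⁻¹).1 1 l = 0 := by
      rw [congrFun hn 1, Pi.smul_apply, hc1, smul_zero]
    have hrow := row_mul_inv A
    simp only [Fin.sum_univ_three] at hrow
    have hl := hrow l l
    have hi := hrow i l
    have hj := hrow j l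
    rw [hn0, hn1, zero_mul, zero_mul, zero_add, zero_add] at hl hi hj
    rw [if_pos rfl] at hl
    rw [if_neg hil] at hi
    rw [if_neg hjl] at hj
    have hn2 : (A⁻¹).1 2 l ≠ 0 := left_ne_zero_of_mul (by rw [hl]; exact one_ne_zero)
    have hq := (mul_eq_zero.mp hi).resolve_left hn2
    have hr := (mul_eq_zero.mp hj).resolve_left hn2
    refine ⟨fun e he => le_of_mem_support_act_vPoly (by omega) hn1 he, ?_⟩
    have hD : A.1 i 0 * A.1 j 1 - A.1 i 1 * A.1 j 0 ≠ 0 := by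
      have h2 := congrFun hn 2
      rw [Pi.smul_apply, cross_apply] at h2
      intro h0
      rw [h2] at hn2
      exact hn2 (by simp [h0])
    obtain ⟨c, hc, h⟩ := coeff_sum_pow_ne_zero (k := k) (by omega) hD
    obtain ⟨d, hd, h1⟩ := exists_monomial_of_flagEval_pderiv A hij hjl hil hw (c := c) (by
      have hF := flagEval_pderiv_w0Poly (k := k) (n := fun m => (A⁻¹).1 m l) hq hr hn0 hn1
      rw [Finset.sum_eq_single 2 (fun m _ hm => by
        rw [map_add, map_add, flagEval_pderiv_Wprime x hq hr, add_zero, hF, if_neg hm, mul_zero])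
        (by simp), map_add, map_add, flagEval_pderiv_Wprime x hq hr, add_zero, hF, if_pos rfl]
      rw [← mul_assoc, ← Polynomial.C_mul, mul_comm (A.1 l 2), hl, Polynomial.C_1, one_mul]
      exact h)
    exact ⟨d, hd, c, hc, h1⟩

end Domination

section NotSemistable

section Topology

variable {E : Type} [AddCommGroup E] [Module ℂ E] [FiniteDimensional ℂ E]

lemma tendsto_moduleTopology {ι : Type*} {l : Filter ι} {c : ι → E} {x : E}
    (h : ∀ φ : Module.Dual ℂ E, Filter.Tendsto (fun t => φ (c t)) l (nhds (φ x))) :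
    Filter.Tendsto c l (@nhds E (moduleTopology ℂ E) x) := by
  let _ := moduleTopology ℂ E
  have := ModuleTopology.continuousAdd ℂ E
  have := ModuleTopology.continuousSMul ℂ E
  let b := Module.finBasis ℂ E
  have h1 : Filter.Tendsto (fun t => b.equivFun (c t)) l (nhds (b.equivFun x)) :=
    tendsto_pi_nhds.mpr fun i => h (b.coord i)
  have h2 : Continuous b.equivFun.symm.toLinearMap := IsModuleTopology.continuous_of_linearMap _
  have h3 := (h2.tendsto (b.equivFun x)).comp h1
  simpa [Function.comp_def] using h3

lemma mk_mem_closure {ι : Type*} {l : Filter ι} [l.NeBot] {c : ι → E} {x : E} (hx : x ≠ 0)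
    (h : ∀ φ : Module.Dual ℂ E, Filter.Tendsto (fun t => φ (c t)) l (nhds (φ x)))
    {S : Set (ℙ ℂ E)} (hS : ∀ t (ht : c t ≠ 0), Projectivization.mk ℂ (c t) ht ∈ S) :
    Projectivization.mk ℂ x hx ∈ @closure _ (projTopology E) S := by
  let _ := moduleTopology ℂ E
  let _ := projTopology E
  rw [mem_closure_iff]
  intro U hU hxU
  obtain ⟨V, hV, hVU⟩ := isOpen_induced_iff.mp (isOpen_coinduced.mp hU)
  have hxV : x ∈ V := by
    have : (⟨x, hx⟩ : {x : E // x ≠ 0}) ∈ Subtype.val ⁻¹' V := by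
      rw [hVU]
      exact hxU
    exact this
  have h0 : ∀ᶠ t in l, c t ≠ 0 := by
    obtain ⟨φ, hφ⟩ : ∃ φ : Module.Dual ℂ E, φ x ≠ 0 := by
      by_contra! h
      exact hx ((Module.forall_dual_apply_eq_zero_iff ℂ x).mp h)
    filter_upwards [(h φ).eventually_ne hφ] with t ht ht0
    rw [ht0, map_zero] at ht
    exact ht rfl
  obtain ⟨t, ht0, htV⟩ := (h0.and ((tendsto_moduleTopology h).eventually_mem (hV.mem_nhds hxV))).exists
  refine ⟨_, ?_, hS t ht0⟩
  have : (⟨c t, ht0⟩ : {x : E // x ≠ 0}) ∈ Subtype.val ⁻¹' V := htV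
  rw [hVU] at this
  exact this

end Topology

/-- A curve in `SL(3, ℂ)`. -/
def degeneration (t : ℂˣ) : SL3 :=
  ⟨!![(t : ℂ)⁻¹, 0, 0; 0, (t : ℂ)⁻¹, 1; 0, 0, (t : ℂ) ^ 2], by
    have := t.ne_zero
    simp [Matrix.det_fin_three]
    field_simp⟩

lemma degeneration_inv (t : ℂˣ) : (degeneration t)⁻¹.1 =
    !![(t : ℂ), 0, 0; 0, (t : ℂ), -(t : ℂ)⁻¹; 0, 0, (t : ℂ)⁻¹ ^ 2] := by
  have := t.ne_zero
  rw [Matrix.SpecialLinearGroup.coe_inv, degeneration, Matrix.adjugate_fin_three]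
  ext i j
  fin_cases i <;> fin_cases j <;> simp <;> field_simp

lemma act_degeneration_eVec (t : ℂˣ) : act (degeneration t) (eVec 0) = C (t : ℂ)⁻¹ * eVec 0 ∧
    act (degeneration t) (eVec 1) = C (t : ℂ)⁻¹ * eVec 1 ∧
      act (degeneration t) (eVec 2) = C (t : ℂ) ^ 2 * eVec 2 + eVec 1 := by
  refine ⟨?_, ?_, ?_⟩ <;> rw [act_eVec, Fin.sum_univ_three] <;> simp [degeneration]
  ring

lemma act_degeneration_eDual (t : ℂˣ) : act (degeneration t) (eDual 0) = C (t : ℂ) * eDual 0 ∧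
    act (degeneration t) (eDual 1) = C (t : ℂ)⁻¹ * (C (t : ℂ) ^ 2 * eDual 1 - eDual 2) ∧
      act (degeneration t) (eDual 2) = C (t : ℂ)⁻¹ ^ 2 * eDual 2 := by
  have h : C (t : ℂ)⁻¹ * C (t : ℂ) = (1 : Poly) := by
    rw [← C_mul, inv_mul_cancel₀ t.ne_zero, C_1]
  refine ⟨?_, ?_, ?_⟩ <;> rw [act_eDual, Fin.sum_univ_three, degeneration_inv] <;> simp
  · linear_combination (-C (t : ℂ) * eDual 1) * h
  · left
    rw [← C_pow, inv_pow]

lemma C_pow_mul_act_vPoly {k : ℕ} (hk : 1 ≤ k) (t : ℂˣ) :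
    C (t : ℂ) ^ (2 * k) * act (degeneration t) (vPoly k) =
      (C (t : ℂ) ^ 2 * eDual 1 - eDual 2) ^ 2 * eDual 2 ^ (k - 1) := by
  have h : C (t : ℂ) * C (t : ℂ)⁻¹ = (1 : Poly) := by
    rw [← C_mul, mul_inv_cancel₀ t.ne_zero, C_1]
  have h1 : C (t : ℂ) ^ (2 * k) * (C (t : ℂ)⁻¹ ^ 2 * (C (t : ℂ)⁻¹ ^ 2) ^ (k - 1)) = (1 : Poly) := by
    rw [← pow_succ', ← pow_mul, show 2 * (k - 1 + 1) = 2 * k by omega, ← mul_pow, h, one_pow]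
  rw [vPoly, map_mul, map_pow, map_pow, (act_degeneration_eDual t).2.1,
    (act_degeneration_eDual t).2.2, mul_pow, mul_pow]
  linear_combination ((C (t : ℂ) ^ 2 * eDual 1 - eDual 2) ^ 2 * eDual 2 ^ (k - 1)) * h1

lemma C_pow_mul_act_w0Poly {k : ℕ} (hk : 1 ≤ k) (t : ℂˣ) :
    C (t : ℂ) ^ (2 * k) * act (degeneration t) (w0Poly k) = C (t : ℂ) * w0Poly k := by
  have h : C (t : ℂ) * C (t : ℂ)⁻¹ = (1 : Poly) := by
    rw [← C_mul, mul_inv_cancel₀ t.ne_zero, C_1]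
  have h1 : C (t : ℂ) ^ (2 * k) * C (t : ℂ)⁻¹ ^ (2 * k - 1) = (C (t : ℂ) : Poly) := by
    obtain ⟨M, hM⟩ : ∃ M, 2 * k = M + 1 := ⟨2 * k - 1, by omega⟩
    rw [hM, Nat.add_sub_cancel, pow_succ, mul_right_comm, ← mul_pow, h, one_pow, one_mul]
  have h0 : act (degeneration t) (eVec 0) * act (degeneration t) (eDual 0) = eVec 0 * eDual 0 := by
    rw [(act_degeneration_eVec t).1, (act_degeneration_eDual t).1]
    linear_combination eVec 0 * eDual 0 * h
  have h2 : act (degeneration t) (eVec 1) * act (degeneration t) (eDual 1) +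
      act (degeneration t) (eVec 2) * act (degeneration t) (eDual 2) =
        eVec 1 * eDual 1 + eVec 2 * eDual 2 := by
    rw [(act_degeneration_eVec t).2.1, (act_degeneration_eDual t).2.1,
      (act_degeneration_eVec t).2.2, (act_degeneration_eDual t).2.2]
    linear_combination (eVec 1 * eDual 1 + eVec 2 * eDual 2) *
      (C (t : ℂ) * C (t : ℂ)⁻¹ + 1) * h
  have p1 : act (degeneration t) (eVec 1) ^ (2 * k - 1) =
      C (t : ℂ)⁻¹ ^ (2 * k - 1) * eVec 1 ^ (2 * k - 1) := by
    rw [(act_degeneration_eVec t).2.1, mul_pow]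
  have p0 : act (degeneration t) (eVec 0) ^ (2 * k - 1) =
      C (t : ℂ)⁻¹ ^ (2 * k - 1) * eVec 0 ^ (2 * k - 1) := by
    rw [(act_degeneration_eVec t).1, mul_pow]
  rw [w0Poly]
  generalize 2 * (k : ℂ) + 1 = a
  generalize -(1 / (k : ℂ)) = b
  simp only [map_add, map_sub, map_mul, map_pow, act_C, h0, p0, p1]
  linear_combination C (t : ℂ) ^ (2 * k) * C (t : ℂ)⁻¹ ^ (2 * k - 1) *
    (eVec 1 ^ (2 * k - 1) + eVec 0 ^ (2 * k - 1)) * h2 +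
    (eVec 1 ^ (2 * k - 1) * (eVec 1 * eDual 1 - C a * (eVec 0 * eDual 0) + eVec 2 * eDual 2) +
      eVec 0 ^ (2 * k - 1) * (C b * (eVec 0 * eDual 0) + eVec 1 * eDual 1 + eVec 2 * eDual 2)) * h1

lemma exists_family_monomial {k : ℕ} {d : Fin 3 ⊕ Fin 3 →₀ ℕ} (a : ℂ)
    (ha : d (Sum.inl 0) + d (Sum.inl 1) + d (Sum.inl 2) = 2 * k)
    (hb : d (Sum.inr 0) + d (Sum.inr 1) + d (Sum.inr 2) = 1)
    (h2 : d (Sum.inr 2) + 2 ≤ d (Sum.inl 2)) :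
    ∃ Q : Polynomial Poly, Q.coeff 0 = 0 ∧ ∀ t : ℂˣ,
      C (t : ℂ) ^ (2 * k) * act (degeneration t) (monomial d a) = Q.eval (C (t : ℂ)) := by
  obtain ⟨e, he⟩ : ∃ e, d (Sum.inl 2) + d (Sum.inr 0) =
    e + 1 + d (Sum.inr 1) + 2 * d (Sum.inr 2) :=
    ⟨d (Sum.inl 2) + d (Sum.inr 0) - 1 - d (Sum.inr 1) - 2 * d (Sum.inr 2), by omega⟩
  refine ⟨Polynomial.X * (Polynomial.X ^ e * Polynomial.C (C a * eVec 0 ^ d (Sum.inl 0) *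
    eVec 1 ^ d (Sum.inl 1) * eDual 0 ^ d (Sum.inr 0) * eDual 2 ^ d (Sum.inr 2)) *
    (Polynomial.X ^ 2 * Polynomial.C (eVec 2) + Polynomial.C (eVec 1)) ^ d (Sum.inl 2) *
    (Polynomial.X ^ 2 * Polynomial.C (eDual 1) - Polynomial.C (eDual 2)) ^ d (Sum.inr 1)),
    Polynomial.coeff_X_mul_zero _, fun t => ?_⟩
  have h : (C (t : ℂ) : Poly) * C (t : ℂ)⁻¹ = 1 := by
    rw [← C_mul, mul_inv_cancel₀ t.ne_zero, C_1]
  have hexp : C (t : ℂ) ^ (2 * k) * (C (t : ℂ)⁻¹ ^ d (Sum.inl 0) * C (t : ℂ)⁻¹ ^ d (Sum.inl 1) *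
      C (t : ℂ) ^ d (Sum.inr 0) * C (t : ℂ)⁻¹ ^ d (Sum.inr 1) *
      (C (t : ℂ)⁻¹ ^ 2) ^ d (Sum.inr 2)) = (C (t : ℂ) * C (t : ℂ) ^ e : Poly) := by
    have h3 : (C (t : ℂ) : Poly) ^ (2 * k) * C (t : ℂ) ^ d (Sum.inr 0) =
        C (t : ℂ) * C (t : ℂ) ^ e * (C (t : ℂ) ^ d (Sum.inl 0) * C (t : ℂ) ^ d (Sum.inl 1) *
          C (t : ℂ) ^ d (Sum.inr 1) * (C (t : ℂ) ^ 2) ^ d (Sum.inr 2)) := by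
      rw [← pow_mul, ← pow_succ']
      simp only [← pow_add]
      congr 1
      omega
    have h4 : ∀ n, (C (t : ℂ) : Poly) ^ n * C (t : ℂ)⁻¹ ^ n = 1 := fun n => by
      rw [← mul_pow, h, one_pow]
    have h5 : ((C (t : ℂ) : Poly) ^ 2) ^ d (Sum.inr 2) * (C (t : ℂ)⁻¹ ^ 2) ^ d (Sum.inr 2) = 1 := by
      rw [← mul_pow, h4, one_pow]
    calc _ = (C (t : ℂ) ^ (2 * k) * C (t : ℂ) ^ d (Sum.inr 0)) *
          (C (t : ℂ)⁻¹ ^ d (Sum.inl 0) * C (t : ℂ)⁻¹ ^ d (Sum.inl 1) * C (t : ℂ)⁻¹ ^ d (Sum.inr 1) *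
            (C (t : ℂ)⁻¹ ^ 2) ^ d (Sum.inr 2)) := by ring
      _ = C (t : ℂ) * C (t : ℂ) ^ e * ((C (t : ℂ) ^ d (Sum.inl 0) * C (t : ℂ)⁻¹ ^ d (Sum.inl 0)) *
          (C (t : ℂ) ^ d (Sum.inl 1) * C (t : ℂ)⁻¹ ^ d (Sum.inl 1)) *
          (C (t : ℂ) ^ d (Sum.inr 1) * C (t : ℂ)⁻¹ ^ d (Sum.inr 1)) *
          ((C (t : ℂ) ^ 2) ^ d (Sum.inr 2) * (C (t : ℂ)⁻¹ ^ 2) ^ d (Sum.inr 2))) := by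
        rw [h3]
        ring
      _ = _ := by
        rw [h4, h4, h4, h5]
        ring
  have hact : act (degeneration t) (monomial d a) = C a *
      ((C (t : ℂ)⁻¹ * eVec 0) ^ d (Sum.inl 0) * (C (t : ℂ)⁻¹ * eVec 1) ^ d (Sum.inl 1) *
        (C (t : ℂ) ^ 2 * eVec 2 + eVec 1) ^ d (Sum.inl 2) *
      ((C (t : ℂ) * eDual 0) ^ d (Sum.inr 0) *
        (C (t : ℂ)⁻¹ * (C (t : ℂ) ^ 2 * eDual 1 - eDual 2)) ^ d (Sum.inr 1) *
        (C (t : ℂ)⁻¹ ^ 2 * eDual 2) ^ d (Sum.inr 2))) := by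
    obtain ⟨e0, e1, e2⟩ := act_degeneration_eVec t
    obtain ⟨f0, f1, f2⟩ := act_degeneration_eDual t
    rw [monomial_eq, Finsupp.prod_fintype _ _ (by simp), map_mul, map_prod, act_C,
      Fintype.prod_sum_type, Fin.prod_univ_three, Fin.prod_univ_three]
    simp only [map_pow]
    rw [← e0, ← e1, ← e2, ← f0, ← f1, ← f2]
    rfl
  rw [hact]
  simp only [Polynomial.eval_mul, Polynomial.eval_pow, Polynomial.eval_add, Polynomial.eval_sub,
    Polynomial.eval_X, Polynomial.eval_C, mul_pow]
  linear_combination (C a * eVec 0 ^ d (Sum.inl 0) *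
    eVec 1 ^ d (Sum.inl 1) * eDual 0 ^ d (Sum.inr 0) * eDual 2 ^ d (Sum.inr 2) *
    (C (t : ℂ) ^ 2 * eVec 2 + eVec 1) ^ d (Sum.inl 2) *
    (C (t : ℂ) ^ 2 * eDual 1 - eDual 2) ^ d (Sum.inr 1)) * hexp

lemma exists_family_Wprime {k : ℕ} (x : Wprime k) :
    ∃ Q : Polynomial Poly, Q.coeff 0 = 0 ∧ ∀ t : ℂˣ,
      C (t : ℂ) ^ (2 * k) * act (degeneration t) (x : Poly) = Q.eval (C (t : ℂ)) := by
  have h : ∀ d : (x : Poly).support, ∃ Q : Polynomial Poly, Q.coeff 0 = 0 ∧ ∀ t : ℂˣ,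
      C (t : ℂ) ^ (2 * k) * act (degeneration t) (monomial d (coeff d (x : Poly))) =
        Q.eval (C (t : ℂ)) := fun d =>
    exists_family_monomial _ (bideg_of_mem_support x.1.2.1 d.2).1
      (bideg_of_mem_support x.1.2.1 d.2).2 (Wprime_support x d.2)
  choose Q hQ0 hQ using h
  refine ⟨∑ d, Q d, ?_, fun t => ?_⟩
  · rw [Polynomial.finsetSum_coeff]
    exact Finset.sum_eq_zero fun d _ => hQ0 d
  · conv_lhs => rw [(x : Poly).as_sum, map_sum, Finset.mul_sum, ← Finset.sum_coe_sort]
    rw [Polynomial.eval_finsetSum]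
    exact Finset.sum_congr rfl fun d _ => hQ d t

lemma tendsto_dual_family (φ : Module.Dual ℂ Poly) (Q : Polynomial Poly) :
    Filter.Tendsto (fun t : ℂˣ => φ (Q.eval (C (t : ℂ))))
      (Filter.comap (fun t : ℂˣ => (t : ℂ)) (nhds 0)) (nhds (φ (Q.coeff 0))) := by
  have h1 : ∀ t : ℂ, φ (Q.eval (C t)) = Q.sum fun n p => t ^ n * φ p := by
    intro t
    rw [Polynomial.eval_eq_sum, Polynomial.sum, map_sum, Polynomial.sum]
    refine Finset.sum_congr rfl fun n _ => ?_
    rw [← C_pow, mul_comm, ← smul_eq_C_mul, map_smul, smul_eq_mul]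
  have h2 : Continuous fun t : ℂ => φ (Q.eval (C t)) := by
    simp only [h1, Polynomial.sum]
    fun_prop
  have h3 := h2.tendsto 0
  simp only [C_0, ← Polynomial.coeff_zero_eq_eval_zero] at h3
  exact h3.comp Filter.tendsto_comap

lemma not_isSemistable {k : ℕ} (hk : 1 ≤ k) (x : Wprime k) :
    ¬ IsSemistable (gamRep 0 (k + 1)) (gamRep (2 * k) 1) (vVec k hk) (w0Vec k hk + x) := by
  let Qv : Polynomial Poly := (Polynomial.X ^ 2 * Polynomial.C (eDual 1) - Polynomial.C (eDual 2)) ^ 2 *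
    Polynomial.C (eDual 2 ^ (k - 1))
  have hQv : ∀ t : ℂˣ, C (t : ℂ) ^ (2 * k) * act (degeneration t) (vPoly k) =
      Qv.eval (C (t : ℂ)) := fun t => by
    rw [C_pow_mul_act_vPoly hk]
    simp only [Qv, Polynomial.eval_mul, Polynomial.eval_pow, Polynomial.eval_sub, Polynomial.eval_X,
      Polynomial.eval_C]
  have hQv0 : Qv.coeff 0 = eDual 2 ^ (k + 1) := by
    rw [Polynomial.coeff_zero_eq_eval_zero]
    simp only [Qv, Polynomial.eval_mul, Polynomial.eval_pow, Polynomial.eval_sub, Polynomial.eval_X,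
      Polynomial.eval_C]
    rw [show k + 1 = 2 + (k - 1) by omega, pow_add]
    ring
  obtain ⟨Qx, hQx0, hQx⟩ := exists_family_Wprime x
  let Qw : Polynomial Poly := Polynomial.X * Polynomial.C (w0Poly k) + Qx
  have hQw : ∀ t : ℂˣ, C (t : ℂ) ^ (2 * k) * act (degeneration t) (w0Poly k + (x : Poly)) =
      Qw.eval (C (t : ℂ)) := fun t => by
    rw [map_add, mul_add, C_pow_mul_act_w0Poly hk, hQx]
    simp only [Qw, Polynomial.eval_mul, Polynomial.eval_add, Polynomial.eval_X, Polynomial.eval_C]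
  have hQw0 : Qw.coeff 0 = 0 := by
    simp [Qw, hQx0]
  have hmem : eDual 2 ^ (k + 1) ∈ Gam 0 (k + 1) := by
    rw [eDual, X_pow_eq_monomial]
    exact monomial_mem_gam (by simp) (by simp) fun i => Or.inl (by simp)
  let p : Gam 0 (k + 1) × Gam (2 * k) 1 := (⟨eDual 2 ^ (k + 1), hmem⟩, 0)
  have hp : p ≠ 0 := fun h => by
    have h1 := congrArg (fun y : Gam 0 (k + 1) × Gam (2 * k) 1 => (y.1 : Poly)) h
    exact pow_ne_zero (k + 1) (X_ne_zero (R := ℂ) (Sum.inr 2 : Fin 3 ⊕ Fin 3)) h1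
  have hbot : (Filter.comap (fun t : ℂˣ => (t : ℂ)) (nhds 0)).NeBot := by
    rw [Filter.comap_neBot_iff]
    intro s hs
    obtain ⟨t, hts, ht⟩ := (Filter.inter_mem (mem_nhdsWithin_of_mem_nhds hs)
      (self_mem_nhdsWithin (s := ({0} : Set ℂ)ᶜ)) : s ∩ {0}ᶜ ∈ nhdsWithin (0 : ℂ) {0}ᶜ) |>
        Filter.nonempty_of_mem
    exact ⟨Units.mk0 t ht, hts⟩
  have hcl : ∀ (y : Gam (2 * k) 1) (Q : Polynomial Poly), Q.coeff 0 = 0 →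
      (∀ t : ℂˣ, C (t : ℂ) ^ (2 * k) * act (degeneration t) (y : Poly) = Q.eval (C (t : ℂ))) →
      Projectivization.mk ℂ p hp ∈ @closure _ (projTopology (Gam 0 (k + 1) × Gam (2 * k) 1))
        (orbit (gamRep 0 (k + 1)) (gamRep (2 * k) 1) (vVec k hk) y) := by
    intro y Q hQ0 hQ
    refine mk_mem_closure (l := Filter.comap (fun t : ℂˣ => (t : ℂ)) (nhds 0))
      (c := fun t : ℂˣ => (t : ℂ) ^ (2 * k) • (gamRep 0 (k + 1) (degeneration t) (vVec k hk),
        gamRep (2 * k) 1 (degeneration t) y)) hp (fun φ => ?_) fun t ht => ?_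
    · obtain ⟨φ₁, h₁⟩ := LinearMap.exists_extend (φ ∘ₗ LinearMap.inl ℂ (Gam 0 (k + 1)) (Gam (2 * k) 1))
      obtain ⟨φ₂, h₂⟩ := LinearMap.exists_extend (φ ∘ₗ LinearMap.inr ℂ (Gam 0 (k + 1)) (Gam (2 * k) 1))
      have hφ : ∀ z : Gam 0 (k + 1) × Gam (2 * k) 1, φ z = φ₁ z.1 + φ₂ z.2 := fun z => by
        have e1 := LinearMap.congr_fun h₁ z.1
        have e2 := LinearMap.congr_fun h₂ z.2
        simp only [LinearMap.comp_apply, Submodule.subtype_apply] at e1 e2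
        rw [e1, e2, ← map_add]
        simp
      simp only [hφ]
      refine Filter.Tendsto.add ?_ ?_
      · have h := tendsto_dual_family φ₁ Qv
        rw [hQv0] at h
        refine h.congr fun t => ?_
        rw [← hQv, ← C_pow, ← smul_eq_C_mul]
        rfl
      · have h := tendsto_dual_family φ₂ Q
        rw [hQ0] at h
        refine h.congr fun t => ?_
        rw [← hQ, ← C_pow, ← smul_eq_C_mul]
        rfl
    · have ht' : (gamRep 0 (k + 1) (degeneration t) (vVec k hk),
          gamRep (2 * k) 1 (degeneration t) y) ≠ 0 := fun h => ht (by
        rw [h, smul_zero])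
      refine ⟨degeneration t, ht', ?_⟩
      rw [Projectivization.mk_eq_mk_iff']
      exact ⟨_, rfl⟩
  intro h
  have h1 := hcl (w0Vec k hk + x) Qw hQw0 hQw
  have h2 := hcl 0 0 (by simp) (by simp)
  have h3 : Projectivization.mk ℂ p hp ∈ (∅ : Set (ℙ ℂ (Gam 0 (k + 1) × Gam (2 * k) 1))) := by
    rw [← h]
    exact ⟨h1, h2⟩
  exact h3

end NotSemistable

end PairStability

end

theorem proposition3p1 (k : ℕ) (hk : 12 ≤ k) :
    Generically fun w' : Wprime k =>
      IsNumSemistable (gamRep 0 (k + 1)) (gamRep (2 * k) 1)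
          (vVec k (by omega)) (w0Vec k (by omega) + w') ∧
        IsNumStable (gamRep 0 (k + 1)) (gamRep (2 * k) 1)
          (vVec k (by omega)) (w0Vec k (by omega) + w') ∧
        ¬ IsSemistable (gamRep 0 (k + 1)) (gamRep (2 * k) 1)
          (vVec k (by omega)) (w0Vec k (by omega) + w') := by
  refine (generically_isGenericVector (by omega)).mono fun x hx => ?_
  obtain ⟨h1, h2⟩ := numStable_of_dominating (by omega) (vVec k (by omega)) (w0Vec k (by omega) + x)
    fun A i j l hij hjl hil => dominatingMonomial_act (by omega) hx A hij hjl hil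
  exact ⟨h1, h2, not_isSemistable (by omega) x⟩
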